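/- Let $p\ge 1$, $\theta=(\theta_1,\dots,\theta_p)\in\mathbb{R}^p$, and let $(\xi_n)_{n\ge 1}$ be a strictly stationary centered Gaussian process on a probability space $(\Omega,\mathcal F,\mathbb{P})$, with covariance function $r(h)=\mathrm{Cov}(\xi_1,\xi_{1+h})$ and $r(0)>0$. Let $$A_0=\begin{pmatrix}\theta_1&\theta_2&\cdots&\cdots&\theta_p\\1&0&\cdots&0&0\\0&1&\cdots&0&0\\ \vdots&&\ddots&&\vdots\\0&\cdots&0&1&0\end{pmatrix}$$ be the companion matrix of $\theta$, and $\ell^1=(1,0,\dots,0)^*\in\mathbb{R}^p$, $\ell=(1,0,\dots,0)^*\in\mathbb{R}^{2p}$. For $n\ge1$ let $\sigma_n\varepsilon_n=\xi_n-\mathbb{E}(\xi_n\mid\xi_1,\dots,\xi_{n-1})$, where $\sigma_n^2$ is the variance of the right-hand side (the innovation) and $\sigma_n\ge 0$; let $k(n,i)$, $1\le i\le n$, with $k(n,n)=1$, be the deterministic coefficients such that $\sigma_n\varepsilon_n=\sum_{i=1}^n k(n,i)\xi_i$ almost surely; let $\beta_n=-k(n+1,1)$, $n\ge1$, be the partial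 autocorrelation function of $(\xi_n)$; and let $\sigma_\infty=\lim_{n\to\infty}\sigma_n$. Let $X_n=\sum_{i=1}^p\theta_iX_{n-i}+\xi_n$ for $n\ge1$ with $X_m=0$ for $m\le 0$, $Y_n=(X_n,\dots,X_{n-p+1})^*$ and $Z_n=\sum_{i=1}^nk(n,i)Y_i$. Define $(\zeta_n)_{n\ge0}$ by $$\zeta_0=0,\qquad \zeta_n=\widetilde A_{n-1}\zeta_{n-1}+\ell\sigma_n\varepsilon_n\quad(n\ge1),\qquad \widetilde A_n=\begin{pmatrix}A_0&\beta_nA_0\\ \beta_n\,\mathrm{Id}_p&\mathrm{Id}_p\end{pmatrix}$$ (the value of $\beta_0$ is irrelevant), and let $\zeta^{(1)}_n\in\mathbb{R}^p$ be the first $p$ components of $\zeta_n$. Assume that * $(H_1)$ the spectral radius of $A_0$ satisfies $\rho(A_0)<1$; * $(H_2)$ $r(n)=O(n^{-\alpha})$ as $n\to\infty$ for some $\alpha>0$; * $(H_3)$ $\beta_n^2=O(n^{-\alpha'})$ as $n\to\infty$ for some $\alpha'>1$. Then: 1. for every $n\ge 0$, almost surely, $\zeta_n=\begin{pmatrix}Z_n\\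 \sum_{j=1}^{n-1}\beta_jZ_j\end{pmatrix}$ (with empty sums equal to $0$); 2. the limit $\sigma_\infty$ exists and $\sigma_\infty>0$; 3. there is exactly one probability law $\mu$ on $\mathbb{R}^p$ that is stationary for the autoregression, that is, such that $A_0x+\ell^1\sigma_\infty e\sim\mu$ whenever $x\sim\mu$ and $e\sim\mathcal N(0,1)$ are independent; 4. let $\gamma_0:\Omega\to\mathbb{R}^p$ be any random vector with law $\mu$, and let $\gamma_n=A_0\gamma_{n-1}+\ell^1\sigma_\infty\varepsilon_n$ for $n\ge1$. If $\gamma_0$ is independent of $(\varepsilon_n)_{n\ge1}$, then $(\gamma_n)_{n\ge 0}$ is strictly stationary and ergodic. Whether or not $\gamma_0$ is independent of $(\varepsilon_n)_{n\ge1}$, $$\left\|\zeta^{(1)}_n-\gamma_n\right\|\xrightarrow[n\to\infty]{}0\quad\text{almost surely},$$ where $\|\cdot\|$ is the Euclidean norm. -/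

import Mathlib

open MeasureTheory ProbabilityTheory Filter Asymptotics
open scoped Topology ENNReal

namespace ARNoise

noncomputable section

section Deterministic

variable {p : ℕ}

/-- The companion matrix of `θ = (θ₁, …, θ_p)`: first row `θ`, ones below the diagonal. -/
def companion (θ : Fin p → ℝ) : Matrix (Fin p) (Fin p) ℝ :=
  Matrix.of fun i j =>
    if (i : ℕ) = 0 then θ j else if (i : ℕ) = (j : ℕ) + 1 then 1 else 0

/-- The vector `(1, 0, …, 0)` of length `p`. -/
def firstVec (p : ℕ) : Fin p → ℝ := fun i => if (i : ℕ) = 0 then 1 else 0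

/-- The vector `(1, 0, …, 0)` of length `2p`, the coordinates being split in two blocks. -/
def firstVec₂ (p : ℕ) : Fin p ⊕ Fin p → ℝ := Sum.elim (firstVec p) 0

/-- The block matrix `(A, bA; b Id, Id)`. -/
def blockTransition (A : Matrix (Fin p) (Fin p) ℝ) (b : ℝ) :
    Matrix (Fin p ⊕ Fin p) (Fin p ⊕ Fin p) ℝ :=
  Matrix.fromBlocks A (b • A) (b • (1 : Matrix (Fin p) (Fin p) ℝ)) 1

/-- `μ` is an invariant probability law of the autoregression `x ↦ A x + (1, 0, …, 0) s e`,
where `e` is standard Gaussian and independent of `x`. -/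
def IsInvariantLaw (A : Matrix (Fin p) (Fin p) ℝ) (s : ℝ) (μ : Measure (Fin p → ℝ)) : Prop :=
  IsProbabilityMeasure μ ∧
    (μ.prod (gaussianReal 0 1)).map
      (fun z : (Fin p → ℝ) × ℝ => A.mulVec z.1 + (s * z.2) • firstVec p) = μ

end Deterministic

/-- The shift on one-sided sequences. -/
def shift {E : Type*} (x : ℕ → E) : ℕ → E := fun n => x (n + 1)

section Stochastic

variable {Ω : Type*} [MeasurableSpace Ω]

/-- Strict stationarity: the law of the whole path is unchanged by time shifts. -/
def IsStrictlyStationary {E : Type*} [MeasurableSpace E] (Y : ℕ → Ω → E) (P : Measure Ω) :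
    Prop :=
  ∀ h : ℕ, P.map (fun ω n => Y (n + h) ω) = P.map (fun ω n => Y n ω)

/-- Ergodicity: the shift is ergodic for the law of the path. -/
def IsErgodicProcess {E : Type*} [MeasurableSpace E] (Y : ℕ → Ω → E) (P : Measure Ω) : Prop :=
  Ergodic shift (P.map (fun ω n => Y n ω))

/-- `(ξ_n)_{n ≥ 1}` is a stationary centered Gaussian process (`ξ 0` plays no role). -/
structure IsStationaryGaussianNoise (ξ : ℕ → Ω → ℝ) (P : Measure Ω) : Prop where
  measurable : ∀ n, 1 ≤ n → Measurable (ξ n)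
  gaussian : IsGaussianProcess (fun n => ξ (n + 1)) P
  centered : ∀ n, 1 ≤ n → ∫ ω, ξ n ω ∂P = 0
  stationary : IsStrictlyStationary (fun n => ξ (n + 1)) P

/-- The covariance function `r(h) = Cov(ξ₁, ξ_{1+h})`. -/
def autocov (ξ : ℕ → Ω → ℝ) (P : Measure Ω) (h : ℕ) : ℝ := cov[ξ 1, ξ (1 + h); P]

/-- The σ-algebra generated by `ξ₁, …, ξ_{n-1}`. -/
abbrev past (ξ : ℕ → Ω → ℝ) (n : ℕ) : MeasurableSpace Ω :=
  ⨆ i ∈ Finset.Ico 1 n, MeasurableSpace.comap (ξ i) inferInstance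

/-- The innovation `ξ_n - E(ξ_n | ξ₁, …, ξ_{n-1})`. -/
def innovation (ξ : ℕ → Ω → ℝ) (P : Measure Ω) (n : ℕ) (ω : Ω) : ℝ :=
  ξ n ω - (P[ξ n | past ξ n]) ω

/-- The standard deviation `σ_n` of the `n`-th innovation. -/
def sigma (ξ : ℕ → Ω → ℝ) (P : Measure Ω) (n : ℕ) : ℝ := √(Var[innovation ξ P n; P])

/-- The normalized innovation `ε_n`. -/
def eps (ξ : ℕ → Ω → ℝ) (P : Measure Ω) (n : ℕ) (ω : Ω) : ℝ :=
  innovation ξ P n ω / sigma ξ P n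

/-- `σ_∞ = lim σ_n`. -/
def sigmaInf (ξ : ℕ → Ω → ℝ) (P : Measure Ω) : ℝ := limUnder atTop (sigma ξ P)

/-- The deterministic kernel `k(n, i)`, `1 ≤ i ≤ n`: the coefficients, with `k(n, n) = 1`, for
which the `n`-th innovation is almost surely `∑_{i=1}^n k(n, i) ξ_i`. For a Gaussian process such
coefficients exist, and they are unique when `ξ₁, …, ξ_n` is non-degenerate. -/
def kernel (ξ : ℕ → Ω → ℝ) (P : Measure Ω) (n : ℕ) : ℕ → ℝ :=
  Classical.epsilon fun a : ℕ → ℝ =>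
    a n = 1 ∧ innovation ξ P n =ᵐ[P] fun ω => ∑ i ∈ Finset.Icc 1 n, a i * ξ i ω

/-- The partial autocorrelation function `β_n = -k(n+1, 1)`, `n ≥ 1`. -/
def pacf (ξ : ℕ → Ω → ℝ) (P : Measure Ω) (n : ℕ) : ℝ := -kernel ξ P (n + 1) 1

variable {p : ℕ}

/-- The process `X_n = ∑_{i=1}^p θ_i X_{n-i} + ξ_n`, `n ≥ 1`, with `X_m = 0` for `m ≤ 0`. Here
`θ i` is `θ_{i+1}`, and the truncated subtraction is correct since all values at times `≤ 0`
vanish. -/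
def arProcess (θ : Fin p → ℝ) (ξ : ℕ → Ω → ℝ) : ℕ → Ω → ℝ
  | 0 => fun _ => 0
  | n + 1 => fun ω => ∑ i : Fin p, θ i * arProcess θ ξ (n - (i : ℕ)) ω + ξ (n + 1) ω
termination_by n => n

/-- `Y_n = (X_n, X_{n-1}, …, X_{n-p+1})`. -/
def arVec (θ : Fin p → ℝ) (ξ : ℕ → Ω → ℝ) (n : ℕ) (ω : Ω) : Fin p → ℝ :=
  fun i => arProcess θ ξ (n - (i : ℕ)) ω

/-- `Z_n = ∑_{i=1}^n k(n, i) Y_i`. -/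
def filteredVec (θ : Fin p → ℝ) (ξ : ℕ → Ω → ℝ) (P : Measure Ω) (n : ℕ) (ω : Ω) : Fin p → ℝ :=
  ∑ i ∈ Finset.Icc 1 n, kernel ξ P n i • arVec θ ξ i ω

/-- The filtered process `(Z_n, ∑_{j=1}^{n-1} β_j Z_j)`. -/
def filteredProcess (θ : Fin p → ℝ) (ξ : ℕ → Ω → ℝ) (P : Measure Ω) (n : ℕ) (ω : Ω) :
    Fin p ⊕ Fin p → ℝ :=
  Sum.elim (filteredVec θ ξ P n ω)
    (∑ j ∈ Finset.Ico 1 n, pacf ξ P j • filteredVec θ ξ P j ω)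

/-- The process `ζ₀ = 0`, `ζ_n = Ã_{n-1} ζ_{n-1} + ℓ σ_n ε_n`. -/
def zeta (θ : Fin p → ℝ) (ξ : ℕ → Ω → ℝ) (P : Measure Ω) : ℕ → Ω → (Fin p ⊕ Fin p → ℝ)
  | 0 => fun _ => 0
  | n + 1 => fun ω =>
      (blockTransition (companion θ) (pacf ξ P n)).mulVec (zeta θ ξ P n ω)
        + (sigma ξ P (n + 1) * eps ξ P (n + 1) ω) • firstVec₂ p

/-- The first `p` components of `ζ_n`. -/
def zetaFirst (θ : Fin p → ℝ) (ξ : ℕ → Ω → ℝ) (P : Measure Ω) (n : ℕ) (ω : Ω) : Fin p → ℝ :=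
  fun i => zeta θ ξ P n ω (Sum.inl i)

/-- The process `γ_n = A₀ γ_{n-1} + ℓ¹ σ_∞ ε_n`, `n ≥ 1`, started at `γ₀`. -/
def limitAR (θ : Fin p → ℝ) (ξ : ℕ → Ω → ℝ) (P : Measure Ω) (γ₀ : Ω → Fin p → ℝ) :
    ℕ → Ω → (Fin p → ℝ)
  | 0 => γ₀
  | n + 1 => fun ω =>
      (companion θ).mulVec (limitAR θ ξ P γ₀ n ω)
        + (sigmaInf ξ P * eps ξ P (n + 1) ω) • firstVec p

end Stochastic

end

end ARNoise

namespace ARNoise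

/-! Write `r` for the covariance and `K` for the kernel. The Durbin–Levinson recursion `K (n+1) i =
K n (i-1) + K (n+1) 1 * K n (n+1-i)` drives parts 1 and 2. It needs the Toeplitz forms of `r` to be
nondegenerate. This follows from `r → 0`, the only consequence of the covariance decay that is used
(`nondegenerate_of_tendsto_zero`).

Applied to the filtered autoregression, the recursion leaves a sum with reversed kernel, which
unfolds to `-∑ β_j Z_j`. Carrying this sum as a second block makes the system Markov
(`filtered_succ`). Applied to variances it gives `σ_{n+1}² = σ_n² (1 - β_n²)`, so summability of
`β_n²` yields a positive limit.

For the convergence, choose a seminorm dominating the norm and contracted by the companion matrix.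
The second block is a sum of `β_j Z_j`. By Cauchy–Schwarz `|β_n| ∑_{j<n} |β_j|` is
`O(n^{(1-α')/2})`, so the perturbation of `ζ^{(1)}` is small even after multiplication by a small
power of `n`. Almost surely the innovations, being i.i.d. standard Gaussian, grow slower than any
such power. Hence `ζ^{(1)}_n - γ_n` obeys a contracting recursion whose forcing tends to zero
(`tendsto_seminorm_sub`). The argument is pathwise, so neither the law of `γ₀` nor its dependence on
the noise matters.

Two paths driven by the same noise differ by `A₀ⁿ (x - y) → 0`. This coupling gives uniqueness of
the invariant law and shows that bounded harmonic functions are almost everywhere constant.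
Existence comes from the series `∑ σ_∞ e_k A₀ᵏ ℓ¹`. Ergodicity is proved for the skew product on
(state, future noise), where sections of an invariant set have harmonic measure
(`preErgodic_arSkew`). It then passes to the path process, which is a factor. -/

/-- The coefficients `K n i`, `1 ≤ i ≤ n`, of the one-step prediction errors of a sequence with
stationary covariance `r`: the last one is `1`, and the error is orthogonal to the past. -/
structure IsPredictionKernel (r : ℕ → ℝ) (K : ℕ → ℕ → ℝ) : Prop where
  diag : ∀ n, 1 ≤ n → K n n = 1
  orth : ∀ n j, 1 ≤ j → j < n → ∑ i ∈ Finset.Icc 1 n, K n i * r (Nat.dist i j) = 0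

/-- The Toeplitz forms of `r` are non-degenerate. -/
def IsNondegenerate (r : ℕ → ℝ) : Prop :=
  ∀ (s : Finset ℕ) (a : ℕ → ℝ), (∀ j ∈ s, ∑ i ∈ s, a i * r (Nat.dist i j) = 0) → ∀ i ∈ s, a i = 0

/-! ### Durbin–Levinson recursion and its consequences for filtered sequences. -/

section Levinson

variable {r : ℕ → ℝ} {K : ℕ → ℕ → ℝ}

lemma sum_Icc_one_split (n : ℕ) (hn : 1 ≤ n) (f : ℕ → ℝ) :
    ∑ i ∈ Finset.Icc 1 (n + 1), f i = f 1 + ∑ i ∈ Finset.Icc 2 n, f i + f (n + 1) := by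
  rw [Finset.sum_Icc_succ_top (by lia), ← Finset.add_sum_Ioc_eq_sum_Icc hn]
  rfl

lemma sum_Icc_shift (n : ℕ) (f : ℕ → ℝ) :
    ∑ i ∈ Finset.Icc 2 (n + 1), f (i - 1) = ∑ i ∈ Finset.Icc 1 n, f i := by
  refine Finset.sum_nbij' (fun i => i - 1) (fun i => i + 1) ?_ ?_ ?_ ?_ ?_ <;>
    simp only [Finset.mem_Icc] <;> intros <;> lia

lemma sum_Icc_reflect (n : ℕ) (f : ℕ → ℝ) :
    ∑ i ∈ Finset.Icc 1 n, f (n + 1 - i) = ∑ i ∈ Finset.Icc 1 n, f i := by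
  refine Finset.sum_nbij' (fun i => n + 1 - i) (fun i => n + 1 - i) ?_ ?_ ?_ ?_ ?_ <;>
    simp only [Finset.mem_Icc] <;> intros <;> lia

lemma dist_reflect {n i j : ℕ} (hi : i ≤ n + 1) (hj : j ≤ n + 1) :
    Nat.dist (n + 1 - i) (n + 1 - j) = Nat.dist i j := by
  simp only [Nat.dist]; lia

/-- The shifted prediction error paired with the variable of index `j`. -/
lemma sum_shift_kernel (n j : ℕ) (hj : 1 ≤ j) :
    ∑ i ∈ Finset.Icc 2 (n + 1), K n (i - 1) * r (Nat.dist i j)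
      = ∑ i ∈ Finset.Icc 1 n, K n i * r (Nat.dist i (j - 1)) := by
  rw [← sum_Icc_shift n (fun i => K n i * r (Nat.dist i (j - 1)))]
  refine Finset.sum_congr rfl fun i hi => ?_
  rw [Finset.mem_Icc] at hi
  congr 2
  simp only [Nat.dist]; lia

/-- The backward prediction error paired with the variable of index `j`. -/
lemma sum_reflect_kernel (n j : ℕ) (hj : j ≤ n + 1) :
    ∑ i ∈ Finset.Icc 1 n, K n (n + 1 - i) * r (Nat.dist i j)
      = ∑ i ∈ Finset.Icc 1 n, K n i * r (Nat.dist i (n + 1 - j)) := by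
  rw [← sum_Icc_reflect n (fun i => K n i * r (Nat.dist i (n + 1 - j)))]
  refine Finset.sum_congr rfl fun i hi => ?_
  rw [Finset.mem_Icc] at hi
  rw [dist_reflect (by lia) hj]

/-- The Durbin–Levinson recursion. -/
lemma IsPredictionKernel.levinson (hK : IsPredictionKernel r K) (hr : IsNondegenerate r)
    {n i : ℕ} (hi : 2 ≤ i) (hin : i ≤ n) :
    K (n + 1) i = K n (i - 1) + K (n + 1) 1 * K n (n + 1 - i) := by
  have hn : 1 ≤ n := by lia
  rw [← sub_eq_zero]
  refine hr (Finset.Icc 2 n)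
    (fun i => K (n + 1) i - (K n (i - 1) + K (n + 1) 1 * K n (n + 1 - i))) ?_ i
    (Finset.mem_Icc.2 ⟨hi, hin⟩)
  intro j hj
  rw [Finset.mem_Icc] at hj
  -- The three orthogonality relations (order `n + 1`, shifted order `n`, reversed order `n`) differ
  -- from sums over `2..n` only by the end terms at `1` and `n + 1`; these cancel in the combination
  -- below.
  have e1 := hK.orth (n + 1) j (by lia) (by lia)
  rw [sum_Icc_one_split n hn, hK.diag _ (by lia)] at e1
  have e2 := sum_shift_kernel (r := r) (K := K) n j (by lia)
  rw [hK.orth n (j - 1) (by lia) (by lia), Finset.sum_Icc_succ_top (by lia), Nat.add_sub_cancel,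
    hK.diag n hn] at e2
  have e3 := sum_reflect_kernel (r := r) (K := K) n j (by lia)
  rw [hK.orth n (n + 1 - j) (by lia) (by lia), ← Finset.add_sum_Ioc_eq_sum_Icc hn,
    Nat.add_sub_cancel, hK.diag n hn] at e3
  have e4 : ∑ i ∈ Finset.Icc 2 n,
        (K (n + 1) i - (K n (i - 1) + K (n + 1) 1 * K n (n + 1 - i))) * r (Nat.dist i j)
      = ∑ i ∈ Finset.Icc 2 n, K (n + 1) i * r (Nat.dist i j)
        - ∑ i ∈ Finset.Icc 2 n, K n (i - 1) * r (Nat.dist i j)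
        - K (n + 1) 1 * ∑ i ∈ Finset.Icc 2 n, K n (n + 1 - i) * r (Nat.dist i j) := by
    rw [Finset.mul_sum, ← Finset.sum_sub_distrib, ← Finset.sum_sub_distrib]
    exact Finset.sum_congr rfl fun i _ => by ring
  have e5 : ∑ i ∈ Finset.Ioc 1 n, K n (n + 1 - i) * r (Nat.dist i j)
      = ∑ i ∈ Finset.Icc 2 n, K n (n + 1 - i) * r (Nat.dist i j) := rfl
  rw [e5] at e3
  rw [e4]
  linear_combination e1 - e2 - K (n + 1) 1 * e3

/-- The recursion for the prediction errors, paired with any variable. -/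
lemma IsPredictionKernel.sum_succ (hK : IsPredictionKernel r K) (hr : IsNondegenerate r)
    {n : ℕ} (hn : 1 ≤ n) (j : ℕ) (hj : 1 ≤ j) (hj' : j ≤ n + 1) :
    ∑ i ∈ Finset.Icc 1 (n + 1), K (n + 1) i * r (Nat.dist i j)
      = ∑ i ∈ Finset.Icc 1 n, K n i * r (Nat.dist i (j - 1))
        + K (n + 1) 1 * ∑ i ∈ Finset.Icc 1 n, K n i * r (Nat.dist i (n + 1 - j)) := by
  rw [← sum_shift_kernel n j hj, ← sum_reflect_kernel n j hj', sum_Icc_one_split n hn,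
    hK.diag (n + 1) (by lia), Finset.sum_Icc_succ_top (by lia), Nat.add_sub_cancel, hK.diag n hn,
    ← Finset.add_sum_Ioc_eq_sum_Icc hn, Nat.add_sub_cancel, hK.diag n hn]
  have e5 : ∑ i ∈ Finset.Ioc 1 n, K n (n + 1 - i) * r (Nat.dist i j)
      = ∑ i ∈ Finset.Icc 2 n, K n (n + 1 - i) * r (Nat.dist i j) := rfl
  have e4 : ∑ i ∈ Finset.Icc 2 n, K (n + 1) i * r (Nat.dist i j)
      = ∑ i ∈ Finset.Icc 2 n, K n (i - 1) * r (Nat.dist i j)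
        + K (n + 1) 1 * ∑ i ∈ Finset.Icc 2 n, K n (n + 1 - i) * r (Nat.dist i j) := by
    rw [Finset.mul_sum, ← Finset.sum_add_distrib]
    refine Finset.sum_congr rfl fun i hi => ?_
    rw [Finset.mem_Icc] at hi
    rw [hK.levinson hr hi.1 hi.2]
    ring
  rw [e5, e4]
  ring

/-- The variance of the prediction errors is multiplied by `1 - β ^ 2` at each step. -/
lemma IsPredictionKernel.variance_succ (hK : IsPredictionKernel r K) (hr : IsNondegenerate r)
    {n : ℕ} (hn : 1 ≤ n) :
    ∑ i ∈ Finset.Icc 1 (n + 1), K (n + 1) i * r (Nat.dist i (n + 1))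
      = (∑ i ∈ Finset.Icc 1 n, K n i * r (Nat.dist i n)) * (1 - K (n + 1) 1 ^ 2) := by
  -- Both relations contain the pairing of the order `n` error with index `0`. Taking `j = 1`, where
  -- the left side vanishes, expresses it through the order `n` variance; substituting into `j = n +
  -- 1` produces the factor.
  have e1 := hK.sum_succ hr hn 1 le_rfl (by lia)
  rw [hK.orth (n + 1) 1 le_rfl (by lia), Nat.add_sub_cancel] at e1
  have e2 := hK.sum_succ hr hn (n + 1) (by lia) le_rfl
  rw [Nat.add_sub_cancel, Nat.sub_self] at e2
  rw [e2]
  linear_combination -K (n + 1) 1 * e1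

section Module

lemma sum_Icc_shift' {E : Type*} [AddCommGroup E] (n : ℕ) (f : ℕ → E) :
    ∑ i ∈ Finset.Icc 1 (n + 1), f i = f 1 + ∑ i ∈ Finset.Icc 1 n, f (i + 1) := by
  rw [← Finset.add_sum_Ioc_eq_sum_Icc (by lia)]
  congr 1
  refine Finset.sum_nbij' (fun i => i - 1) (fun i => i + 1) ?_ ?_ ?_ ?_ ?_ <;>
    simp only [Finset.mem_Icc, Finset.mem_Ioc] <;> intros <;> first | lia | skip
  congr 1; lia

variable {E : Type*} [AddCommGroup E] [Module ℝ E]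

/-- Levinson with the top index split off: both kernels equal `1` there, so the reversed sum stops
before `n`. -/
lemma IsPredictionKernel.sum_smul_succ (hK : IsPredictionKernel r K) (hr : IsNondegenerate r)
    {n : ℕ} (hn : 1 ≤ n) (y : ℕ → E) :
    ∑ i ∈ Finset.Icc 1 n, K (n + 1) (i + 1) • y i
      = ∑ i ∈ Finset.Icc 1 n, K n i • y i
        + K (n + 1) 1 • ∑ i ∈ Finset.Ico 1 n, K n (n - i) • y i := by
  obtain ⟨m, rfl⟩ : ∃ m, n = m + 1 := ⟨n - 1, by lia⟩
  rw [Finset.sum_Icc_succ_top (by lia), Finset.sum_Icc_succ_top (by lia), hK.diag _ (by lia),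
    hK.diag _ (by lia), Finset.smul_sum]
  have : ∑ i ∈ Finset.Icc 1 m, K (m + 1 + 1) (i + 1) • y i
      = ∑ i ∈ Finset.Icc 1 m, K (m + 1) i • y i
        + ∑ i ∈ Finset.Ico 1 (m + 1), K (m + 1 + 1) 1 • K (m + 1) (m + 1 - i) • y i := by
    rw [show Finset.Ico 1 (m + 1) = Finset.Icc 1 m from rfl, ← Finset.sum_add_distrib]
    refine Finset.sum_congr rfl fun i hi => ?_
    rw [Finset.mem_Icc] at hi
    rw [hK.levinson hr (by lia) (by lia), add_smul, mul_smul, Nat.add_sub_cancel,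
      Nat.add_sub_add_right]
  rw [this]
  abel

/-- Passing from `n` to `n + 1`, Levinson adds exactly `K (n + 1) 1` times the filtered sum of order
`n`, so the reversed sum telescopes. This is what makes the second block of the Markov process a sum
of `β_j Z_j`. -/
lemma IsPredictionKernel.sum_reverse (hK : IsPredictionKernel r K) (hr : IsNondegenerate r)
    (n : ℕ) (y : ℕ → E) :
    ∑ i ∈ Finset.Ico 1 n, K n (n - i) • y i
      = ∑ j ∈ Finset.Ico 1 n, K (j + 1) 1 • ∑ i ∈ Finset.Icc 1 j, K j i • y i := by
  induction n with
  | zero => simp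
  | succ n ih =>
    rcases Nat.eq_zero_or_pos n with rfl | hn
    · simp
    rw [Finset.sum_Ico_succ_top hn, Finset.sum_Ico_succ_top hn, ← ih]
    obtain ⟨m, rfl⟩ : ∃ m, n = m + 1 := ⟨n - 1, by lia⟩
    rw [Finset.sum_Icc_succ_top (by lia), hK.diag _ hn, Nat.add_sub_cancel_left, smul_add, one_smul,
      ← add_assoc]
    congr 1
    rw [show Finset.Icc 1 m = Finset.Ico 1 (m + 1) from rfl, Finset.smul_sum,
      ← Finset.sum_add_distrib]
    refine Finset.sum_congr rfl fun i hi => ?_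
    rw [Finset.mem_Ico] at hi
    rw [hK.levinson hr (by lia) (by lia), add_smul, mul_smul,
      show m + 1 + 1 - i - 1 = m + 1 - i by lia,
      show m + 1 + 1 - (m + 1 + 1 - i) = i by lia]

/-- The Markov structure of the filtered autoregression. -/
lemma IsPredictionKernel.filtered_succ (hK : IsPredictionKernel r K) (hr : IsNondegenerate r)
    (n : ℕ) (A : E →ₗ[ℝ] E) (l : E) (x : ℕ → ℝ) (y : ℕ → E) (hy0 : y 0 = 0)
    (hy : ∀ i, y (i + 1) = A (y i) + x (i + 1) • l) :
    ∑ i ∈ Finset.Icc 1 (n + 1), K (n + 1) i • y i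
      = A (∑ i ∈ Finset.Icc 1 n, K n i • y i)
        + K (n + 1) 1 • A (∑ j ∈ Finset.Ico 1 n, K (j + 1) 1 • ∑ i ∈ Finset.Icc 1 j, K j i • y i)
        + (∑ i ∈ Finset.Icc 1 (n + 1), K (n + 1) i * x i) • l := by
  have h1 : ∑ i ∈ Finset.Icc 1 (n + 1), K (n + 1) i • y i
      = A (∑ i ∈ Finset.Icc 1 (n + 1), K (n + 1) i • y (i - 1))
        + (∑ i ∈ Finset.Icc 1 (n + 1), K (n + 1) i * x i) • l := by
    rw [map_sum, Finset.sum_smul, ← Finset.sum_add_distrib]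
    refine Finset.sum_congr rfl fun i hi => ?_
    rw [Finset.mem_Icc] at hi
    obtain ⟨m, rfl⟩ : ∃ m, i = m + 1 := ⟨i - 1, by lia⟩
    rw [hy, smul_add, Nat.add_sub_cancel, map_smul, mul_smul]
  rw [h1, sum_Icc_shift', Nat.sub_self, hy0, smul_zero, zero_add]
  congr 1
  simp only [Nat.add_sub_cancel]
  rcases Nat.eq_zero_or_pos n with rfl | hn
  · simp
  rw [hK.sum_smul_succ hr hn, hK.sum_reverse hr, map_add, map_smul]

end Module

end Levinson

/-! ### Nondegeneracy and projections for stationary sequences in a Hilbert space. -/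

section Hilbert

variable {H : Type*} [NormedAddCommGroup H] [InnerProductSpace ℝ H]

/-- A stationary sequence whose covariance vanishes at infinity cannot stay in a
finite-dimensional space. -/
lemma not_forall_mem_finiteDimensional {r : ℕ → ℝ} {x : ℕ → H}
    (hx : ∀ i j, inner ℝ (x i) (x j) = r (Nat.dist i j)) (hr0 : r 0 ≠ 0)
    (hr : Tendsto r atTop (𝓝 0)) (N : ℕ)
    (hV : ∀ m, x m ∈ Submodule.span ℝ (x '' Set.Iio N)) : False := by
  set V := Submodule.span ℝ (x '' Set.Iio N) with hVdef
  have : FiniteDimensional ℝ V := FiniteDimensional.span_of_finite ℝ ((Set.finite_Iio N).image x)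
  -- Decay of `r` makes `x m` tend weakly to zero against `V`. In finite dimension this forces the
  -- norm to zero, although its square is constantly `r 0`.
  have hweak : ∀ v ∈ V, Tendsto (fun m => inner ℝ v (x m)) atTop (𝓝 0) := by
    intro v hv
    induction hv using Submodule.span_induction with
    | mem v hv =>
      obtain ⟨i, -, rfl⟩ := hv
      simp only [hx]
      refine hr.comp (tendsto_atTop_mono (fun m => ?_) (tendsto_sub_atTop_nat i))
      simp only [Nat.dist]; lia
    | zero => simp
    | add u v _ _ hu hv => simpa [inner_add_left] using hu.add hv
    | smul c v _ hv => simpa [inner_smul_left] using hv.const_mul c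
  let b := stdOrthonormalBasis ℝ V
  have hsum : ∀ m, r 0 = ∑ i, inner ℝ (b i : H) (x m) ^ 2 := by
    intro m
    have h1 := b.sum_sq_inner_right (⟨x m, hV m⟩ : V)
    have h2 : ‖(⟨x m, hV m⟩ : V)‖ ^ 2 = r 0 := by
      rw [← real_inner_self_eq_norm_sq, Submodule.coe_inner, hx]; simp [Nat.dist]
    rw [← h2, ← h1]
    simp
  have hlim : Tendsto (fun m => ∑ i, inner ℝ (b i : H) (x m) ^ 2) atTop (𝓝 0) := by
    have := tendsto_finsetSum Finset.univ
      (fun i _ => (hweak (b i : H) (b i).2).pow 2)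
    simpa using this
  exact hr0 (tendsto_nhds_unique (tendsto_const_nhds.congr hsum) hlim)

/-- A vanishing combination remains vanishing after every time shift, by stationarity. Solving for
the largest index then puts all later vectors in the span of the first `N`, contradicting the
preceding lemma. -/
lemma nondegenerate_of_tendsto_zero {r : ℕ → ℝ} {x : ℕ → H}
    (hx : ∀ i j, inner ℝ (x i) (x j) = r (Nat.dist i j)) (hr0 : r 0 ≠ 0)
    (hr : Tendsto r atTop (𝓝 0)) : IsNondegenerate r := by
  intro s a ha
  by_contra! hcon
  obtain ⟨i₀, hi₀, hai₀⟩ := hcon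
  -- the largest index carrying a nonzero coefficient
  set t := s.filter (fun i => a i ≠ 0) with ht
  have htne : t.Nonempty := ⟨i₀, by simp [ht, hi₀, hai₀]⟩
  set N := t.max' htne with hN
  have hNt : N ∈ t := t.max'_mem htne
  have hNs : N ∈ s ∧ a N ≠ 0 := by simpa [ht] using hNt
  -- the combination vanishes, and so do its shifts
  have hshift : ∀ m, ∑ i ∈ t, a i • x (i + m) = 0 := by
    intro m
    rw [← inner_self_eq_zero (𝕜 := ℝ), sum_inner]
    have hts : ∀ j ∈ s, ∑ i ∈ t, a i * r (Nat.dist i j) = 0 := by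
      intro j hj
      rw [← ha j hj, ht, Finset.sum_filter_of_ne]
      intro i _ h h0
      exact h (by rw [h0, zero_mul])
    have : ∀ i ∈ t, inner ℝ (a i • x (i + m)) (∑ j ∈ t, a j • x (j + m)) = 0 := by
      intro i hi
      have his : i ∈ s := (Finset.mem_filter.1 hi).1
      have h1 : ∑ j ∈ t, inner ℝ (x (i + m)) (a j • x (j + m)) = 0 := by
        rw [← hts i his]
        refine Finset.sum_congr rfl fun j _ => ?_
        rw [real_inner_smul_right, hx, Nat.dist_add_add_right, Nat.dist_comm]
      rw [real_inner_smul_left, inner_sum, h1, mul_zero]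
    exact Finset.sum_eq_zero this
  have hmem : ∀ m, x m ∈ Submodule.span ℝ (x '' Set.Iio N) := by
    intro m
    induction m using Nat.strong_induction_on with
    | _ m ih =>
      by_cases hm : m < N
      · exact Submodule.subset_span ⟨m, hm, rfl⟩
      have h := hshift (m - N)
      rw [← Finset.add_sum_erase t _ hNt, show N + (m - N) = m by lia] at h
      have h2 : x m = -(a N)⁻¹ • ∑ i ∈ t.erase N, a i • x (i + (m - N)) := by
        rw [neg_smul, ← smul_neg, ← eq_neg_of_add_eq_zero_left h, smul_smul,
          inv_mul_cancel₀ hNs.2, one_smul]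
      rw [h2]
      refine Submodule.smul_mem _ _ (Submodule.sum_mem _ fun i hi =>
        Submodule.smul_mem _ _ (ih _ ?_))
      have h3 : i ≤ N := t.le_max' i (Finset.mem_of_mem_erase hi)
      have h4 : i ≠ N := Finset.ne_of_mem_erase hi
      lia
  exact not_forall_mem_finiteDimensional hx hr0 hr N hmem

/-- Existence of the coefficients of the orthogonal projection on finitely many vectors. -/
lemma exists_projection_coeff (x : ℕ → H) (y : H) (s : Finset ℕ) :
    ∃ b : ℕ → ℝ, ∀ j ∈ s, inner ℝ (y - ∑ i ∈ s, b i • x i) (x j) = 0 := by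
  have : FiniteDimensional ℝ (Submodule.span ℝ (x '' (s : Set ℕ))) :=
    FiniteDimensional.span_of_finite ℝ (s.finite_toSet.image x)
  obtain ⟨b, hb⟩ := (Submodule.mem_span_image_finset_iff_exists_fun' ℝ).1
    ((Submodule.span ℝ (x '' (s : Set ℕ))).starProjection_apply_mem y)
  refine ⟨b, fun j hj => ?_⟩
  rw [hb]
  exact Submodule.starProjection_inner_eq_zero _ _ (Submodule.subset_span ⟨j, hj, rfl⟩)

lemma exists_prediction_coeff {r : ℕ → ℝ} {x : ℕ → H}
    (hx : ∀ i j, inner ℝ (x i) (x j) = r (Nat.dist i j)) {n : ℕ} (hn : 1 ≤ n) :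
    ∃ a : ℕ → ℝ, a n = 1 ∧
      ∀ j, 1 ≤ j → j < n → ∑ i ∈ Finset.Icc 1 n, a i * r (Nat.dist i j) = 0 := by
  obtain ⟨b, hb⟩ := exists_projection_coeff x (x n) (Finset.Ico 1 n)
  refine ⟨fun i => if i = n then 1 else -b i, by simp, fun j h1 h2 => ?_⟩
  have h := hb j (Finset.mem_Ico.2 ⟨h1, h2⟩)
  rw [inner_sub_left, sum_inner, hx] at h
  rw [← Finset.Ico_insert_right hn, Finset.sum_insert (by simp)]
  beta_reduce
  rw [if_pos rfl, one_mul, ← h,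
    sub_eq_add_neg, ← Finset.sum_neg_distrib]
  congr 1
  refine Finset.sum_congr rfl fun i hi => ?_
  rw [Finset.mem_Ico] at hi
  rw [if_neg (by lia), real_inner_smul_left, hx, neg_mul]

end Hilbert

/-! ### Innovations of a stationary Gaussian sequence. -/

section GaussianNoise

/-- Presents the past as generated by one random vector, the form in which Gaussian independence is
obtained. -/
lemma past_eq_comap {Ω : Type*} {ξ : ℕ → Ω → ℝ} (n : ℕ) :
    past ξ n = MeasurableSpace.comap (fun ω (i : Finset.Ico 1 n) => ξ i ω) inferInstance := by
  rw [MeasurableSpace.pi, MeasurableSpace.comap_iSup]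
  simp only [MeasurableSpace.comap_comp]
  rw [past, iSup_subtype]
  rfl

variable {Ω : Type*} [MeasurableSpace Ω] {P : Measure Ω} {ξ : ℕ → Ω → ℝ}

lemma covariance_congr_ae {X X' Y Y' : Ω → ℝ} (hX : X =ᵐ[P] X') (hY : Y =ᵐ[P] Y') :
    cov[X, Y; P] = cov[X', Y'; P] := by
  rw [covariance, covariance, integral_congr_ae hX, integral_congr_ae hY]
  refine integral_congr_ae ?_
  filter_upwards [hX, hY] with ω h1 h2
  rw [h1, h2]

lemma IsStationaryGaussianNoise.memLp (hξ : IsStationaryGaussianNoise ξ P) {n : ℕ} (hn : 1 ≤ n) :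
    MemLp (ξ n) 2 P := by
  obtain ⟨m, rfl⟩ : ∃ m, n = m + 1 := ⟨n - 1, by lia⟩
  exact (hξ.gaussian.hasGaussianLaw_eval m).memLp_two

/-- Finite linear combinations of the noise form a Gaussian process. -/
lemma IsStationaryGaussianNoise.isGaussianProcess_sum (hξ : IsStationaryGaussianNoise ξ P)
    {T : Type*} (s : T → Finset ℕ) (hs : ∀ t, ∀ i ∈ s t, 1 ≤ i) (a : T → ℕ → ℝ) :
    IsGaussianProcess (fun t ω => ∑ i ∈ s t, a t i * ξ i ω) P := by
  refine hξ.gaussian.of_isGaussianProcess fun t =>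
    ⟨(s t).image (fun i => i - 1), ∑ i ∈ (s t).attach,
      a t i • ContinuousLinearMap.proj ⟨(i : ℕ) - 1, Finset.mem_image.2 ⟨i, i.2, rfl⟩⟩, ?_⟩
  intro ω
  rw [_root_.sum_apply, ← Finset.sum_attach]
  refine Finset.sum_congr rfl fun i _ => ?_
  have : (i : ℕ) - 1 + 1 = i := Nat.sub_add_cancel (hs t i i.2)
  simp [this]

lemma past_le (hξ : IsStationaryGaussianNoise ξ P) (n : ℕ) : past ξ n ≤ ‹MeasurableSpace Ω› :=
  iSup₂_le fun i hi => (hξ.measurable i (Finset.mem_Ico.1 hi).1).comap_le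

lemma sigma_sq (n : ℕ) : sigma ξ P n ^ 2 = Var[innovation ξ P n; P] :=
  Real.sq_sqrt (variance_nonneg _ _)

lemma IsStationaryGaussianNoise.cov_add (hξ : IsStationaryGaussianNoise ξ P) (m h : ℕ) :
    cov[ξ (m + 1), ξ (m + 1 + h); P] = autocov ξ P h := by
  have hmeas : ∀ k, Measurable fun ω (n : ℕ) => ξ (n + k + 1) ω := fun k =>
    measurable_pi_lambda _ fun n => hξ.measurable _ (by lia)
  have key : ∀ k, cov[ξ (k + 1), ξ (k + 1 + h); P]
      = cov[fun x : ℕ → ℝ => x 0, fun x => x h; P.map fun ω (n : ℕ) => ξ (n + k + 1) ω] := by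
    intro k
    rw [covariance_map_fun (measurable_pi_apply _).aestronglyMeasurable
      (measurable_pi_apply _).aestronglyMeasurable (hmeas k).aemeasurable]
    congr 1
    · ext ω; simp
    · ext ω; congr 1; lia
  have h0 := key 0
  rw [show (0 + 1 : ℕ) = 1 from rfl] at h0
  rw [key m, autocov, h0]
  have := hξ.stationary m
  rw [this]

lemma IsStationaryGaussianNoise.cov_eq (hξ : IsStationaryGaussianNoise ξ P) {i j : ℕ} (hi : 1 ≤ i)
    (hj : 1 ≤ j) : cov[ξ i, ξ j; P] = autocov ξ P (Nat.dist i j) := by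
  wlog hij : i ≤ j generalizing i j
  · rw [covariance_comm, this hj hi (by lia), Nat.dist_comm]
  obtain ⟨m, rfl⟩ : ∃ m, i = m + 1 := ⟨i - 1, by lia⟩
  obtain ⟨h, rfl⟩ := Nat.exists_eq_add_of_le hij
  rw [hξ.cov_add, Nat.dist_eq_sub_of_le (by lia), Nat.add_sub_cancel_left]

lemma IsStationaryGaussianNoise.memLp_sum (hξ : IsStationaryGaussianNoise ξ P) (a : ℕ → ℝ)
    (s : Finset ℕ) (hs : ∀ i ∈ s, 1 ≤ i) : MemLp (fun ω => ∑ i ∈ s, a i * ξ i ω) 2 P :=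
  memLp_finsetSum _ fun i hi => (hξ.memLp (hs i hi)).const_mul (a i)

lemma IsStationaryGaussianNoise.measurable_innovation (hξ : IsStationaryGaussianNoise ξ P) {n : ℕ}
    (hn : 1 ≤ n) : Measurable (innovation ξ P n) :=
  (hξ.measurable n hn).sub (stronglyMeasurable_condExp.measurable.mono (past_le hξ n) le_rfl)

lemma IsStationaryGaussianNoise.measurable_eps (hξ : IsStationaryGaussianNoise ξ P) {n : ℕ}
    (hn : 1 ≤ n) : Measurable (eps ξ P n) :=
  (hξ.measurable_innovation hn).div_const _

variable [IsProbabilityMeasure P]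

lemma IsStationaryGaussianNoise.integral_mul (hξ : IsStationaryGaussianNoise ξ P) {i j : ℕ}
    (hi : 1 ≤ i) (hj : 1 ≤ j) : ∫ ω, ξ i ω * ξ j ω ∂P = autocov ξ P (Nat.dist i j) := by
  rw [← hξ.cov_eq hi hj, covariance_eq_sub (hξ.memLp hi) (hξ.memLp hj), hξ.centered i hi]
  simp

/-- The noise is a stationary sequence of `L²`. -/
lemma IsStationaryGaussianNoise.exists_hilbert (hξ : IsStationaryGaussianNoise ξ P) :
    ∃ x : ℕ → Lp ℝ 2 P, ∀ i j, inner ℝ (x i) (x j) = autocov ξ P (Nat.dist i j) := by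
  refine ⟨fun i => (hξ.memLp (n := i + 1) (by lia)).toLp, fun i j => ?_⟩
  rw [L2.inner_def, ← Nat.dist_add_add_right i 1 j, ← hξ.integral_mul (by lia) (by lia)]
  refine integral_congr_ae ?_
  filter_upwards [(hξ.memLp (n := i + 1) (by lia)).coeFn_toLp,
    (hξ.memLp (n := j + 1) (by lia)).coeFn_toLp] with ω h1 h2
  rw [h1, h2]
  simp [mul_comm]

lemma IsStationaryGaussianNoise.nondegenerate (hξ : IsStationaryGaussianNoise ξ P)
    (hvar : 0 < autocov ξ P 0) (hr : Tendsto (autocov ξ P) atTop (𝓝 0)) :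
    IsNondegenerate (autocov ξ P) := by
  obtain ⟨x, hx⟩ := hξ.exists_hilbert
  exact nondegenerate_of_tendsto_zero hx hvar.ne' hr

lemma IsStationaryGaussianNoise.cov_sum (hξ : IsStationaryGaussianNoise ξ P) (a : ℕ → ℝ)
    (s : Finset ℕ) (hs : ∀ i ∈ s, 1 ≤ i) {j : ℕ} (hj : 1 ≤ j) :
    cov[fun ω => ∑ i ∈ s, a i * ξ i ω, ξ j; P] = ∑ i ∈ s, a i * autocov ξ P (Nat.dist i j) := by
  rw [covariance_fun_sum_left' (fun i hi => (hξ.memLp (hs i hi)).const_mul (a i)) (hξ.memLp hj)]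
  refine Finset.sum_congr rfl fun i hi => ?_
  rw [covariance_const_mul_left, hξ.cov_eq (hs i hi) hj]

lemma IsStationaryGaussianNoise.cov_sum_sum (hξ : IsStationaryGaussianNoise ξ P) (a b : ℕ → ℝ)
    (s t : Finset ℕ) (hs : ∀ i ∈ s, 1 ≤ i) (ht : ∀ i ∈ t, 1 ≤ i) :
    cov[fun ω => ∑ i ∈ s, a i * ξ i ω, fun ω => ∑ j ∈ t, b j * ξ j ω; P]
      = ∑ j ∈ t, b j * ∑ i ∈ s, a i * autocov ξ P (Nat.dist i j) := by
  rw [covariance_fun_sum_right' (fun j hj => (hξ.memLp (ht j hj)).const_mul (b j))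
    (hξ.memLp_sum a s hs)]
  refine Finset.sum_congr rfl fun j hj => ?_
  rw [covariance_const_mul_right, hξ.cov_sum a s hs (ht j hj)]

lemma IsStationaryGaussianNoise.integral_sum (hξ : IsStationaryGaussianNoise ξ P) (a : ℕ → ℝ)
    (s : Finset ℕ) (hs : ∀ i ∈ s, 1 ≤ i) : ∫ ω, ∑ i ∈ s, a i * ξ i ω ∂P = 0 := by
  rw [integral_finsetSum _ fun i hi => ((hξ.memLp (hs i hi)).integrable (by norm_num)).const_mul _]
  refine Finset.sum_eq_zero fun i hi => ?_
  rw [integral_const_mul, hξ.centered i (hs i hi), mul_zero]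

/-- A linear combination of the noise orthogonal to the past has zero conditional expectation. -/
lemma IsStationaryGaussianNoise.condExp_sum_eq_zero (hξ : IsStationaryGaussianNoise ξ P) {n : ℕ}
    (a : ℕ → ℝ)
    (ha : ∀ j, 1 ≤ j → j < n →
      ∑ i ∈ Finset.Icc 1 n, a i * autocov ξ P (Nat.dist i j) = 0) :
    P[fun ω => ∑ i ∈ Finset.Icc 1 n, a i * ξ i ω | past ξ n] =ᵐ[P] 0 := by
  set f : Ω → ℝ := fun ω => ∑ i ∈ Finset.Icc 1 n, a i * ξ i ω with hf
  have h1 : ∀ i ∈ Finset.Icc 1 n, 1 ≤ i := fun i hi => (Finset.mem_Icc.1 hi).1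
  have hfm : Measurable f :=
    Finset.measurable_sum _ fun i hi => (hξ.measurable i (h1 i hi)).const_mul _
  -- Joint Gaussianity of `f` with the past is what turns zero covariance into independence, hence a
  -- constant conditional expectation.
  have hG : IsGaussianProcess (Sum.elim (fun _ : Unit => f)
      (fun (j : Finset.Ico 1 n) => ξ j)) P := by
    have := hξ.isGaussianProcess_sum (T := Unit ⊕ Finset.Ico 1 n)
      (Sum.elim (fun _ => Finset.Icc 1 n) (fun j => {(j : ℕ)}))
      (by
        rintro (u | j) i hi
        · exact h1 i hi
        · rw [Sum.elim_inr, Finset.mem_singleton] at hi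
          rw [hi]
          exact (Finset.mem_Ico.1 j.2).1)
      (Sum.elim (fun _ => a) (fun _ _ => 1))
    convert this using 1
    ext t ω
    rcases t with u | j <;> simp [hf]
  have hind : IndepFun (fun ω (_ : Unit) => f ω) (fun ω (j : Finset.Ico 1 n) => ξ j ω) P := by
    refine hG.indepFun_of_covariance_eq_zero (fun _ => hfm.aemeasurable)
      (fun j => (hξ.measurable j (Finset.mem_Ico.1 j.2).1).aemeasurable) fun _ j => ?_
    have hj := Finset.mem_Ico.1 j.2
    rw [hf, hξ.cov_sum a _ h1 hj.1, ha j hj.1 hj.2]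
  have hind' : Indep (MeasurableSpace.comap f inferInstance) (past ξ n) P := by
    rw [past_eq_comap]
    exact (hind.comp (φ := fun x : Unit → ℝ => x ()) (ψ := id) (by fun_prop) measurable_id)
  have := condExp_indep_eq hfm.comap_le (past_le hξ n)
    (comap_measurable f).stronglyMeasurable hind'
  filter_upwards [this] with ω hω
  rw [hω, hξ.integral_sum a _ h1]
  rfl

/-- The combination is `ξ n + g` with `g` measurable for the past. Its conditional expectation is
zero, so that of `ξ n` is `-g`. -/
lemma IsStationaryGaussianNoise.innovation_eq (hξ : IsStationaryGaussianNoise ξ P) {n : ℕ}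
    (hn : 1 ≤ n) (a : ℕ → ℝ) (han : a n = 1)
    (ha : ∀ j, 1 ≤ j → j < n →
      ∑ i ∈ Finset.Icc 1 n, a i * autocov ξ P (Nat.dist i j) = 0) :
    innovation ξ P n =ᵐ[P] fun ω => ∑ i ∈ Finset.Icc 1 n, a i * ξ i ω := by
  set g : Ω → ℝ := fun ω => ∑ i ∈ Finset.Ico 1 n, a i * ξ i ω with hg
  have hsum : ∀ ω, ∑ i ∈ Finset.Icc 1 n, a i * ξ i ω = ξ n ω + g ω := by
    intro ω
    rw [← Finset.Ico_insert_right hn, Finset.sum_insert (by simp), han, one_mul]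
  have h1 : ∀ i ∈ Finset.Ico 1 n, 1 ≤ i := fun i hi => (Finset.mem_Ico.1 hi).1
  have hgint : Integrable g P := (hξ.memLp_sum a _ h1).integrable (by norm_num)
  have hgm : StronglyMeasurable[past ξ n] g := by
    refine Measurable.stronglyMeasurable ?_
    refine Finset.measurable_sum _ fun i hi => Measurable.const_mul ?_ _
    exact (comap_measurable (ξ i)).mono
      (le_iSup₂ (f := fun i (_ : i ∈ Finset.Ico 1 n) =>
        MeasurableSpace.comap (ξ i) inferInstance) i hi) le_rfl
  have h0 := hξ.condExp_sum_eq_zero a ha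
  have h2 : P[fun ω => ∑ i ∈ Finset.Icc 1 n, a i * ξ i ω | past ξ n]
      =ᵐ[P] P[ξ n | past ξ n] + g := by
    have e : (fun ω => ∑ i ∈ Finset.Icc 1 n, a i * ξ i ω) = ξ n + g := funext hsum
    rw [e]
    refine (condExp_add ((hξ.memLp hn).integrable (by norm_num)) hgint _).trans ?_
    rw [condExp_of_stronglyMeasurable (past_le hξ n) hgm hgint]
  filter_upwards [h0, h2] with ω h3 h4
  rw [h4] at h3
  simp only [Pi.add_apply, Pi.zero_apply] at h3
  rw [innovation, hsum]
  linarith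

lemma IsStationaryGaussianNoise.kernel_spec (hξ : IsStationaryGaussianNoise ξ P) {n : ℕ}
    (hn : 1 ≤ n) : kernel ξ P n n = 1 ∧
      innovation ξ P n =ᵐ[P] fun ω => ∑ i ∈ Finset.Icc 1 n, kernel ξ P n i * ξ i ω := by
  obtain ⟨x, hx⟩ := hξ.exists_hilbert
  obtain ⟨a, ha, hao⟩ := exists_prediction_coeff hx hn
  exact Classical.epsilon_spec (p := fun a : ℕ → ℝ =>
    a n = 1 ∧ innovation ξ P n =ᵐ[P] fun ω => ∑ i ∈ Finset.Icc 1 n, a i * ξ i ω)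
    ⟨a, ha, hξ.innovation_eq hn a ha hao⟩

/-- The kernel is chosen by `Classical.epsilon`, without any orthogonality requirement. It
represents the same innovation as the projection coefficients, so its covariances with the past
agree with theirs and vanish. -/
lemma IsStationaryGaussianNoise.isPredictionKernel (hξ : IsStationaryGaussianNoise ξ P) :
    IsPredictionKernel (autocov ξ P) (kernel ξ P) := by
  refine ⟨fun n hn => (hξ.kernel_spec hn).1, fun n j hj hjn => ?_⟩
  have hn : 1 ≤ n := by lia
  obtain ⟨x, hx⟩ := hξ.exists_hilbert
  obtain ⟨a, ha, hao⟩ := exists_prediction_coeff hx hn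
  have h1 : ∀ i ∈ Finset.Icc 1 n, 1 ≤ i := fun i hi => (Finset.mem_Icc.1 hi).1
  rw [← hξ.cov_sum _ _ h1 hj, ← hao j hj hjn, ← hξ.cov_sum _ _ h1 hj]
  exact covariance_congr_ae
    ((hξ.kernel_spec hn).2.symm.trans (hξ.innovation_eq hn a ha hao)) ae_eq_rfl

lemma IsStationaryGaussianNoise.cov_innovation (hξ : IsStationaryGaussianNoise ξ P) {m n : ℕ}
    (hm : 1 ≤ m) (hmn : m < n) : cov[innovation ξ P n, innovation ξ P m; P] = 0 := by
  have h1 : ∀ n, ∀ i ∈ Finset.Icc 1 n, 1 ≤ i := fun n i hi => (Finset.mem_Icc.1 hi).1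
  rw [covariance_congr_ae (hξ.kernel_spec (n := n) (by lia)).2 (hξ.kernel_spec hm).2,
    hξ.cov_sum_sum _ _ _ _ (h1 n) (h1 m)]
  refine Finset.sum_eq_zero fun j hj => ?_
  rw [Finset.mem_Icc] at hj
  rw [hξ.isPredictionKernel.orth n j hj.1 (by lia), mul_zero]

lemma IsStationaryGaussianNoise.variance_innovation (hξ : IsStationaryGaussianNoise ξ P) {n : ℕ}
    (hn : 1 ≤ n) : Var[innovation ξ P n; P]
      = ∑ i ∈ Finset.Icc 1 n, kernel ξ P n i * autocov ξ P (Nat.dist i n) := by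
  have h1 : ∀ i ∈ Finset.Icc 1 n, 1 ≤ i := fun i hi => (Finset.mem_Icc.1 hi).1
  rw [← covariance_self (hξ.measurable_innovation hn).aemeasurable,
    covariance_congr_ae (hξ.kernel_spec hn).2 (hξ.kernel_spec hn).2,
    hξ.cov_sum_sum _ _ _ _ h1 h1, Finset.sum_eq_single n]
  · rw [hξ.isPredictionKernel.diag n hn, one_mul]
  · intro j hj hjn
    rw [Finset.mem_Icc] at hj
    rw [hξ.isPredictionKernel.orth n j hj.1 (by lia), mul_zero]
  · simp [hn]

lemma IsStationaryGaussianNoise.sigma_pos (hξ : IsStationaryGaussianNoise ξ P)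
    (hr : IsNondegenerate (autocov ξ P)) {n : ℕ} (hn : 1 ≤ n) : 0 < sigma ξ P n := by
  refine Real.sqrt_pos.2 (lt_of_le_of_ne (variance_nonneg _ _) fun h0 => ?_)
  rw [hξ.variance_innovation hn] at h0
  have := hr (Finset.Icc 1 n) (kernel ξ P n) (fun j hj => ?_) n (by simp [hn])
  · rw [hξ.isPredictionKernel.diag n hn] at this
    exact one_ne_zero this
  · rw [Finset.mem_Icc] at hj
    rcases hj.2.lt_or_eq with h | rfl
    · exact hξ.isPredictionKernel.orth n j hj.1 h
    · exact h0.symm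

lemma IsStationaryGaussianNoise.sigma_sq_succ (hξ : IsStationaryGaussianNoise ξ P)
    (hr : IsNondegenerate (autocov ξ P)) {n : ℕ} (hn : 1 ≤ n) :
    sigma ξ P (n + 1) ^ 2 = sigma ξ P n ^ 2 * (1 - pacf ξ P n ^ 2) := by
  rw [sigma_sq, sigma_sq, hξ.variance_innovation hn, hξ.variance_innovation (by lia),
    hξ.isPredictionKernel.variance_succ hr hn, pacf, neg_sq]

lemma IsStationaryGaussianNoise.sigma_mul_eps (hξ : IsStationaryGaussianNoise ξ P)
    (hr : IsNondegenerate (autocov ξ P)) {n : ℕ} (hn : 1 ≤ n) (ω : Ω) :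
    sigma ξ P n * eps ξ P n ω = innovation ξ P n ω :=
  mul_div_cancel₀ _ (hξ.sigma_pos hr hn).ne'

lemma IsStationaryGaussianNoise.isGaussianProcess_eps (hξ : IsStationaryGaussianNoise ξ P) :
    IsGaussianProcess (fun n => eps ξ P (n + 1)) P := by
  refine (hξ.isGaussianProcess_sum (fun n : ℕ => Finset.Icc 1 (n + 1))
    (fun n i hi => (Finset.mem_Icc.1 hi).1)
    (fun n i => kernel ξ P (n + 1) i / sigma ξ P (n + 1))).congr fun n => ?_
  filter_upwards [(hξ.kernel_spec (n := n + 1) (by lia)).2] with ω hω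
  rw [eps, hω, Finset.sum_div]
  exact Finset.sum_congr rfl fun i _ => by ring

lemma IsStationaryGaussianNoise.hasLaw_eps (hξ : IsStationaryGaussianNoise ξ P)
    (hr : IsNondegenerate (autocov ξ P)) (n : ℕ) :
    HasLaw (eps ξ P (n + 1)) (gaussianReal 0 1) P := by
  refine ⟨(hξ.measurable_eps (by lia)).aemeasurable, ?_⟩
  have hσ := hξ.sigma_pos hr (n := n + 1) (by lia)
  have h1 : ∀ i ∈ Finset.Icc 1 (n + 1), 1 ≤ i := fun i hi => (Finset.mem_Icc.1 hi).1
  have hmean : ∫ ω, eps ξ P (n + 1) ω ∂P = 0 := by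
    simp only [eps]
    rw [integral_div, integral_congr_ae (hξ.kernel_spec (n := n + 1) (by lia)).2,
      hξ.integral_sum _ _ h1, zero_div]
  have hvar : Var[eps ξ P (n + 1); P] = 1 := by
    have : eps ξ P (n + 1) = fun ω => (sigma ξ P (n + 1))⁻¹ * innovation ξ P (n + 1) ω := by
      ext ω; rw [eps, div_eq_inv_mul]
    rw [this, variance_const_mul, ← sigma_sq, inv_pow, inv_mul_cancel₀ (pow_pos hσ 2).ne']
  rw [(hξ.isGaussianProcess_eps.hasGaussianLaw_eval n).map_eq_gaussianReal, hmean, hvar]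
  simp

lemma IsStationaryGaussianNoise.cov_eps (hξ : IsStationaryGaussianNoise ξ P) {m n : ℕ}
    (hm : 1 ≤ m) (hn : 1 ≤ n) (hmn : m ≠ n) : cov[eps ξ P m, eps ξ P n; P] = 0 := by
  wlog h : n < m generalizing m n
  · rw [covariance_comm]
    exact this hn hm hmn.symm (by lia)
  have : ∀ n, eps ξ P n = fun ω => (sigma ξ P n)⁻¹ * innovation ξ P n ω := by
    intro n; ext ω; rw [eps, div_eq_inv_mul]
  rw [this, this, covariance_const_mul_left, covariance_const_mul_right,
    hξ.cov_innovation hn h]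
  simp

/-- The normalized innovations are independent standard Gaussian variables. -/
lemma IsStationaryGaussianNoise.hasLaw_eps_seq (hξ : IsStationaryGaussianNoise ξ P)
    (hr : IsNondegenerate (autocov ξ P)) :
    HasLaw (fun ω (n : ℕ) => eps ξ P (n + 1) ω)
      (Measure.infinitePi fun _ : ℕ => gaussianReal 0 1) P := by
  refine iIndepFun.hasLaw_infinitePi (fun n => hξ.hasLaw_eps hr n) ?_
    (measurable_pi_lambda _ fun n => hξ.measurable_eps (by lia)).aemeasurable
  -- Each innovation is viewed as a process indexed by `Unit`, since the independence criterion
  -- concerns a family of processes.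
  have hG : IsGaussianProcess (fun (q : (_ : ℕ) × Unit) ω => eps ξ P (q.1 + 1) ω) P :=
    hξ.isGaussianProcess_eps.comp_right (fun q : (_ : ℕ) × Unit => q.1)
  have := hG.iIndepFun_of_covariance_eq_zero (X := fun n (_ : Unit) => eps ξ P (n + 1))
    (fun n _ => (hξ.measurable_eps (by lia)).aemeasurable)
    (fun m n hmn _ _ => hξ.cov_eps (by lia) (by lia) (by lia))
  exact this.comp (fun _ x => x ()) (fun _ => by fun_prop)

end GaussianNoise

/-! ### Markov structure of the filtered process. -/

section Filtered

variable {Ω : Type*} {p : ℕ}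

lemma arVec_zero (θ : Fin p → ℝ) (ξ : ℕ → Ω → ℝ) (ω : Ω) : arVec θ ξ 0 ω = 0 := by
  ext i
  simp [arVec, arProcess]

lemma arVec_succ (θ : Fin p → ℝ) (ξ : ℕ → Ω → ℝ) (n : ℕ) (ω : Ω) :
    arVec θ ξ (n + 1) ω = (companion θ).mulVec (arVec θ ξ n ω) + ξ (n + 1) ω • firstVec p := by
  ext i
  rcases Nat.eq_zero_or_pos (i : ℕ) with hi | hi
  · simp [arVec, hi, arProcess, Matrix.mulVec, dotProduct, companion, firstVec]
  · simp only [arVec, companion, Matrix.mulVec, dotProduct, Pi.add_apply, Pi.smul_apply, firstVec,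
      Matrix.of_apply, if_neg hi.ne', smul_zero, add_zero]
    rw [Finset.sum_eq_single ⟨(i : ℕ) - 1, by lia⟩]
    · rw [if_pos (Nat.sub_add_cancel hi).symm, one_mul]
      congr 1
      simp only
      lia
    · intro j _ hj
      rw [if_neg, zero_mul]
      intro h
      exact hj (Fin.ext (by simp only; lia))
    · simp

lemma blockTransition_mulVec (A : Matrix (Fin p) (Fin p) ℝ) (b : ℝ) (u v : Fin p → ℝ) :
    (blockTransition A b).mulVec (Sum.elim u v)
      = Sum.elim (A.mulVec u + b • A.mulVec v) (b • u + v) := by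
  rw [blockTransition, Matrix.fromBlocks_mulVec]
  simp [Matrix.smul_mulVec]

variable [MeasurableSpace Ω] {P : Measure Ω} {ξ : ℕ → Ω → ℝ}

lemma zeta_succ (θ : Fin p → ℝ) (n : ℕ) (ω : Ω) :
    zeta θ ξ P (n + 1) ω
      = (blockTransition (companion θ) (pacf ξ P n)).mulVec (zeta θ ξ P n ω)
        + (sigma ξ P (n + 1) * eps ξ P (n + 1) ω) • firstVec₂ p := rfl

variable [IsProbabilityMeasure P]

lemma IsStationaryGaussianNoise.filteredVec_succ (hξ : IsStationaryGaussianNoise ξ P)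
    (hr : IsNondegenerate (autocov ξ P)) (θ : Fin p → ℝ) (n : ℕ) :
    ∀ᵐ ω ∂P, filteredVec θ ξ P (n + 1) ω
      = (companion θ).mulVec (filteredVec θ ξ P n ω)
        + pacf ξ P n • (companion θ).mulVec
            (∑ j ∈ Finset.Ico 1 n, pacf ξ P j • filteredVec θ ξ P j ω)
        + (sigma ξ P (n + 1) * eps ξ P (n + 1) ω) • firstVec p := by
  filter_upwards [(hξ.kernel_spec (n := n + 1) (by lia)).2] with ω hω
  rw [hξ.sigma_mul_eps hr (by lia), hω]
  have := hξ.isPredictionKernel.filtered_succ hr n (companion θ).mulVecLin (firstVec p)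
    (fun i => ξ i ω) (fun i => arVec θ ξ i ω) (arVec_zero θ ξ ω) (fun i => arVec_succ θ ξ i ω)
  simp only [filteredVec]
  rw [this]
  simp only [Matrix.mulVecLin_apply, pacf, neg_smul, Finset.sum_neg_distrib, Matrix.mulVec_neg,
    smul_neg, neg_neg]

lemma IsStationaryGaussianNoise.filteredProcess_eq_zeta (hξ : IsStationaryGaussianNoise ξ P)
    (hr : IsNondegenerate (autocov ξ P)) (θ : Fin p → ℝ) (n : ℕ) :
    ∀ᵐ ω ∂P, filteredProcess θ ξ P n ω = zeta θ ξ P n ω := by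
  induction n with
  | zero =>
    refine ae_of_all _ fun ω => ?_
    ext (i | i) <;> simp [filteredProcess, filteredVec, zeta]
  | succ n ih =>
    filter_upwards [ih, hξ.filteredVec_succ hr θ n] with ω h1 h2
    rw [zeta_succ, ← h1, filteredProcess, filteredProcess, blockTransition_mulVec, h2]
    -- At `n = 0` the left sum is empty; the extra term on the right is harmless because `Z_0 = 0`,
    -- whatever `β_0` is.
    have h3 : ∑ j ∈ Finset.Ico 1 (n + 1), pacf ξ P j • filteredVec θ ξ P j ω
        = pacf ξ P n • filteredVec θ ξ P n ω
          + ∑ j ∈ Finset.Ico 1 n, pacf ξ P j • filteredVec θ ξ P j ω := by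
      rcases Nat.eq_zero_or_pos n with rfl | hn
      · simp [filteredVec]
      · rw [Finset.sum_Ico_succ_top hn, add_comm]
    rw [h3]
    ext (i | i) <;> simp [firstVec₂]

end Filtered

/-! ### Positive limit of the innovation variances. -/

section Sigma

/-- A positive sequence with `a (n + 1) = a n * (1 - b n)` and summable `b` has a positive
limit, and the rate of convergence is controlled by the summability of weighted sums. -/
lemma exists_tendsto_of_mul_one_sub {a b : ℕ → ℝ} (ha : ∀ n, 0 < a n) (hb : ∀ n, 0 ≤ b n)
    (hs : Summable b) (h : ∀ n, a (n + 1) = a n * (1 - b n)) :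
    ∃ L, 0 < L ∧ Tendsto a atTop (𝓝 L) ∧ (∀ n, L ≤ a n) ∧
      ∀ w : ℕ → ℝ, Monotone w → (∀ n, 0 ≤ w n) → Summable (fun n => w n * b n) →
        Tendsto (fun n => w n * (a n - L)) atTop (𝓝 0) := by
  have hanti : Antitone a := antitone_nat_of_succ_le fun n => by
    rw [h]
    nlinarith [mul_nonneg (ha n).le (hb n)]
  have hbdd : BddBelow (Set.range a) := ⟨0, by rintro _ ⟨n, rfl⟩; exact (ha n).le⟩
  have hlim := tendsto_atTop_ciInf hanti hbdd
  have hle : ∀ n, ⨅ i, a i ≤ a n := fun n => ciInf_le hbdd n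
  refine ⟨⨅ n, a n, ?_, hlim, hle, ?_⟩
  · have htail := tendsto_sum_nat_add b
    obtain ⟨N, hN⟩ := (htail.eventually (gt_mem_nhds (show (0 : ℝ) < 1 / 2 by norm_num))).exists
    -- Since `N` was chosen with tail sum of `b` below `1/2`, this bound keeps `a` above `a N / 2`
    -- from there on.
    have key : ∀ m, a N * (1 - ∑ k ∈ Finset.range m, b (k + N)) ≤ a (m + N) := by
      intro m
      induction m with
      | zero => simp
      | succ m ih =>
        rw [Finset.sum_range_succ, show m + 1 + N = m + N + 1 by lia, h]
        have h1 : a (m + N) ≤ a N := hanti (by lia)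
        nlinarith [mul_le_mul_of_nonneg_right h1 (hb (m + N))]
    have hge : ∀ m, a N * (1 / 2) ≤ a m := by
      intro m
      refine le_trans ?_ ((key m).trans (hanti (show m ≤ m + N by lia)))
      have h2 : ∑ k ∈ Finset.range m, b (k + N) ≤ ∑' k, b (k + N) :=
        ((summable_nat_add_iff N).2 hs).sum_le_tsum _ fun k _ => hb _
      exact mul_le_mul_of_nonneg_left (by linarith) (ha N).le
    exact lt_of_lt_of_le (mul_pos (ha N) (by norm_num)) (le_ciInf hge)
  · intro w hw hw0 hws
    have htail := (tendsto_sum_nat_add fun n => w n * b n).const_mul (a 0)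
    rw [mul_zero] at htail
    refine tendsto_of_tendsto_of_tendsto_of_le_of_le tendsto_const_nhds htail
      (fun n => mul_nonneg (hw0 n) (sub_nonneg.2 (hle n))) fun n => ?_
    -- Telescoping: each decrement `a k * b k` is at most `a 0 * b k`, and monotonicity moves the
    -- weight from `n` to the later index.
    have key : ∀ m, w n * (a n - a (m + n)) ≤
        a 0 * ∑ k ∈ Finset.range m, w (k + n) * b (k + n) := by
      intro m
      induction m with
      | zero => simp
      | succ m ih =>
        rw [Finset.sum_range_succ, show m + 1 + n = m + n + 1 by lia, h]
        have h1 : w n * (a (m + n) * b (m + n)) ≤ w (m + n) * (a 0 * b (m + n)) :=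
          mul_le_mul (hw (by lia)) (mul_le_mul_of_nonneg_right (hanti (by lia)) (hb _))
            (mul_nonneg (ha _).le (hb _)) (hw0 _)
        nlinarith
    have key2 : ∀ m, w n * (a n - a (m + n)) ≤ a 0 * ∑' k, w (k + n) * b (k + n) := fun m =>
      (key m).trans (mul_le_mul_of_nonneg_left
        (((summable_nat_add_iff n).2 hws).sum_le_tsum _ fun k _ => mul_nonneg (hw0 _) (hb _))
        (ha 0).le)
    refine le_of_tendsto (((tendsto_const_nhds.sub
      ((tendsto_add_atTop_iff_nat n).2 hlim)).const_mul (w n))) (Eventually.of_forall key2)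

variable {Ω : Type*} [MeasurableSpace Ω] {P : Measure Ω} [IsProbabilityMeasure P] {ξ : ℕ → Ω → ℝ}

/-- The product recursion holds for `σ²`; its rate passes to `σ` because `√L (σ - √L) ≤ σ² - L` when
`σ ≥ √L`. Indices start at `1`, the variance recursion being available only from there. -/
lemma IsStationaryGaussianNoise.tendsto_sigma (hξ : IsStationaryGaussianNoise ξ P)
    (hr : IsNondegenerate (autocov ξ P)) (hs : Summable fun n => pacf ξ P n ^ 2) :
    0 < sigmaInf ξ P ∧ Tendsto (sigma ξ P) atTop (𝓝 (sigmaInf ξ P)) ∧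
      ∀ w : ℕ → ℝ, Monotone w → (∀ n, 0 ≤ w n) → Summable (fun n => w n * pacf ξ P (n + 1) ^ 2) →
        Tendsto (fun n => w n * (sigma ξ P (n + 1) - sigmaInf ξ P)) atTop (𝓝 0) := by
  have hpos : ∀ n, 0 < sigma ξ P (n + 1) := fun n => hξ.sigma_pos hr (by lia)
  obtain ⟨L, hL, hlim, hle, hrate⟩ := exists_tendsto_of_mul_one_sub
    (a := fun n => sigma ξ P (n + 1) ^ 2) (b := fun n => pacf ξ P (n + 1) ^ 2)
    (fun n => pow_pos (hpos n) 2) (fun n => sq_nonneg _)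
    ((summable_nat_add_iff 1).2 hs) (fun n => hξ.sigma_sq_succ hr (by lia))
  have hsig : Tendsto (sigma ξ P) atTop (𝓝 √L) := by
    rw [← tendsto_add_atTop_iff_nat 1]
    refine ((Real.continuous_sqrt.tendsto L).comp hlim).congr fun n => ?_
    exact Real.sqrt_sq (hpos n).le
  have hinf : sigmaInf ξ P = √L := hsig.limUnder_eq
  have hsL : 0 < √L := Real.sqrt_pos.2 hL
  rw [hinf]
  refine ⟨hsL, hsig, fun w hw hw0 hws => ?_⟩
  have h1 := (hrate w hw hw0 hws).const_mul (√L)⁻¹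
  rw [mul_zero] at h1
  have hge : ∀ n, √L ≤ sigma ξ P (n + 1) := fun n => by
    rw [Real.sqrt_le_left (hpos n).le]
    exact hle n
  refine tendsto_of_tendsto_of_tendsto_of_le_of_le tendsto_const_nhds h1
      (fun n => mul_nonneg (hw0 n) (sub_nonneg.2 (hge n))) fun n => ?_
  rw [le_inv_mul_iff₀ hsL, mul_left_comm]
  refine mul_le_mul_of_nonneg_left ?_ (hw0 n)
  have : L = √L ^ 2 := (Real.sq_sqrt hL.le).symm
  nlinarith [hge n, hpos n]

end Sigma

/-! ### Contracting recursions with a summed memory term. -/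

section Stability

lemma tendsto_zero_of_le_mul_add {q : ℝ} (hq0 : 0 ≤ q) (hq1 : q < 1) {d v : ℕ → ℝ}
    (hd : ∀ n, 0 ≤ d n) (hv : Tendsto v atTop (𝓝 0)) (h : ∀ n, d (n + 1) ≤ q * d n + v n) :
    Tendsto d atTop (𝓝 0) := by
  rw [Metric.tendsto_atTop]
  intro ε hε
  obtain ⟨N, hN⟩ := eventually_atTop.1
    (hv.eventually (gt_mem_nhds (show (0 : ℝ) < (1 - q) * (ε / 2) by
      have := sub_pos.2 hq1; positivity)))
  have key : ∀ k, d (k + N) ≤ ε / 2 + q ^ k * d N := by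
    intro k
    induction k with
    | zero => simp; linarith
    | succ k ih =>
      have h1 := h (k + N)
      have h2 := hN (k + N) (by lia)
      have h3 := mul_le_mul_of_nonneg_left ih hq0
      rw [show k + 1 + N = k + N + 1 by lia, pow_succ]
      nlinarith
  have h4 : Tendsto (fun k => q ^ k * d N) atTop (𝓝 0) := by
    simpa using (tendsto_pow_atTop_nhds_zero_of_lt_one hq0 hq1).mul_const (d N)
  obtain ⟨M, hM⟩ := eventually_atTop.1 (h4.eventually (gt_mem_nhds (half_pos hε)))
  refine ⟨M + N, fun n hn => ?_⟩
  obtain ⟨k, rfl⟩ : ∃ k, n = k + N := ⟨n - N, by lia⟩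
  rw [Real.dist_eq, sub_zero, abs_of_nonneg (hd _)]
  have := key k
  have := hM k (by lia)
  linarith

variable {E : Type*} [AddCommGroup E] [Module ℝ E]

lemma seminorm_sum_le (N : Seminorm ℝ E) {β : ℕ → ℝ} {Z W : ℕ → E} (hW0 : W 0 = 0)
    (hW : ∀ n, W (n + 1) = β n • Z n + W n) (n : ℕ) (c : ℝ) (hc : ∀ j < n, N (Z j) ≤ c) :
    N (W n) ≤ (∑ j ∈ Finset.range n, |β j|) * c := by
  induction n with
  | zero => simp [hW0]
  | succ n ih =>
    rw [hW, Finset.sum_range_succ]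
    refine (map_add_le_add N _ _).trans ?_
    rw [map_smul_eq_mul, Real.norm_eq_abs]
    have h1 := ih fun j hj => hc j (by lia)
    have h2 := mul_le_mul_of_nonneg_left (hc n (by lia)) (abs_nonneg (β n))
    linarith

/-- Polynomial growth of the perturbed recursion. -/
lemma exists_le_weight (N : Seminorm ℝ E) {A : E →ₗ[ℝ] E} {q : ℝ} (hq0 : 0 ≤ q) (hq1 : q < 1)
    (hA : ∀ x, N (A x) ≤ q * N x) {β w : ℕ → ℝ} (hw : Monotone w) (hw1 : ∀ n, 1 ≤ w n)
    (hb : Tendsto (fun n => |β n| * ∑ j ∈ Finset.range n, |β j|) atTop (𝓝 0))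
    {Z W u : ℕ → E} (hW0 : W 0 = 0)
    (hW : ∀ n, W (n + 1) = β n • Z n + W n)
    (hZ : ∀ n, Z (n + 1) = A (Z n) + β n • A (W n) + u n)
    {K : ℝ} (hu : ∀ n, N (u n) ≤ K * w n) : ∃ M, 0 ≤ M ∧ ∀ n, N (Z n) ≤ M * w n := by
  have hη : 0 < (1 - q) / 2 := by linarith
  obtain ⟨n₀, hn₀⟩ := eventually_atTop.1 (hb.eventually (gt_mem_nhds hη))
  -- The contraction contributes `q`, and the memory and noise terms at most `(1 - q) / 2` each, so
  -- the induction closes with total factor `1`. The first entry of the maximum covers times up to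
  -- `n₀`, where the memory bound may fail.
  set M := max (∑ j ∈ Finset.range (n₀ + 1), N (Z j)) (K / ((1 - q) / 2)) with hM
  have hM0 : 0 ≤ M := le_max_of_le_left (Finset.sum_nonneg fun j _ => apply_nonneg N _)
  have hMK : K ≤ (1 - q) / 2 * M := by
    have : K / ((1 - q) / 2) ≤ M := le_max_right _ _
    rw [div_le_iff₀ hη] at this
    linarith
  refine ⟨M, hM0, fun n => ?_⟩
  induction n using Nat.strong_induction_on with
  | _ n ih =>
    by_cases hn : n ≤ n₀
    · have h1 : N (Z n) ≤ M := le_max_of_le_left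
        (Finset.single_le_sum (f := fun j => N (Z j)) (fun j _ => apply_nonneg N _)
          (Finset.mem_range.2 (by lia)))
      nlinarith [hw1 n]
    · obtain ⟨m, rfl⟩ : ∃ m, n = m + 1 := ⟨n - 1, by lia⟩
      have hw0 : 0 ≤ w m := zero_le_one.trans (hw1 m)
      have hZm : N (Z m) ≤ M * w m := ih m (by lia)
      have hWm : N (W m) ≤ (∑ j ∈ Finset.range m, |β j|) * (M * w m) :=
        seminorm_sum_le N hW0 hW m _ fun j hj => (ih j (by lia)).trans
          (mul_le_mul_of_nonneg_left (hw hj.le) hM0)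
      have h1 : N (β m • A (W m)) ≤ (1 - q) / 2 * (M * w m) := by
        rw [map_smul_eq_mul, Real.norm_eq_abs]
        have h2 : N (A (W m)) ≤ (∑ j ∈ Finset.range m, |β j|) * (M * w m) := by
          refine (hA _).trans (le_trans ?_ hWm)
          nlinarith [apply_nonneg N (W m)]
        calc |β m| * N (A (W m)) ≤ |β m| * ((∑ j ∈ Finset.range m, |β j|) * (M * w m)) :=
              mul_le_mul_of_nonneg_left h2 (abs_nonneg _)
          _ = (|β m| * ∑ j ∈ Finset.range m, |β j|) * (M * w m) := by ring
          _ ≤ _ := mul_le_mul_of_nonneg_right (hn₀ m (by lia)).le (mul_nonneg hM0 hw0)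
      rw [hZ]
      have h3 : N (A (Z m)) ≤ q * (M * w m) :=
        (hA _).trans (mul_le_mul_of_nonneg_left hZm hq0)
      have h4 : N (u m) ≤ (1 - q) / 2 * M * w m :=
        (hu m).trans (mul_le_mul_of_nonneg_right hMK hw0)
      have h5 : N (A (Z m) + β m • A (W m) + u m) ≤ N (A (Z m)) + N (β m • A (W m)) + N (u m) :=
        (map_add_le_add N _ _).trans (add_le_add_left (map_add_le_add N _ _) _)
      have h6 : M * w m ≤ M * w (m + 1) := mul_le_mul_of_nonneg_left (hw (by lia)) hM0
      linarith

/-- The perturbed recursion is asymptotically equal to the unperturbed one. -/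
lemma tendsto_seminorm_sub (N : Seminorm ℝ E) {A : E →ₗ[ℝ] E} {q : ℝ} (hq0 : 0 ≤ q) (hq1 : q < 1)
    (hA : ∀ x, N (A x) ≤ q * N x) {β w : ℕ → ℝ} (hw : Monotone w) (hw1 : ∀ n, 1 ≤ w n)
    (hb : Tendsto (fun n => w n * (|β n| * ∑ j ∈ Finset.range n, |β j|)) atTop (𝓝 0))
    {σ e : ℕ → ℝ} {s : ℝ} (hσ : Tendsto σ atTop (𝓝 s))
    (hσw : Tendsto (fun n => w n * (σ n - s)) atTop (𝓝 0)) {C : ℝ} (he : ∀ n, |e n| ≤ C * w n)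
    (l : E) {Z W G : ℕ → E} (hW0 : W 0 = 0) (hW : ∀ n, W (n + 1) = β n • Z n + W n)
    (hZ : ∀ n, Z (n + 1) = A (Z n) + β n • A (W n) + (σ n * e n) • l)
    (hG : ∀ n, G (n + 1) = A (G n) + (s * e n) • l) :
    Tendsto (fun n => N (Z n - G n)) atTop (𝓝 0) := by
  have hb0 : ∀ n, 0 ≤ |β n| * ∑ j ∈ Finset.range n, |β j| := fun n =>
    mul_nonneg (abs_nonneg _) (Finset.sum_nonneg fun _ _ => abs_nonneg _)
  have hw0 : ∀ n, 0 ≤ w n := fun n => zero_le_one.trans (hw1 n)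
  have hb' : Tendsto (fun n => |β n| * ∑ j ∈ Finset.range n, |β j|) atTop (𝓝 0) :=
    tendsto_of_tendsto_of_tendsto_of_le_of_le tendsto_const_nhds hb hb0
      fun n => le_mul_of_one_le_left (hb0 n) (hw1 n)
  obtain ⟨S, hS⟩ := hσ.abs.bddAbove_range
  have hS' : ∀ n, |σ n| ≤ S := fun n => hS ⟨n, rfl⟩
  have hS0 : 0 ≤ S := (abs_nonneg _).trans (hS' 0)
  obtain ⟨M, hM0, hM⟩ := exists_le_weight N hq0 hq1 hA hw hw1 hb' hW0 hW hZ
    (K := S * C * N l) (fun n => by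
      rw [map_smul_eq_mul, Real.norm_eq_abs, abs_mul]
      have := mul_le_mul (hS' n) (he n) (abs_nonneg _) hS0
      nlinarith [apply_nonneg N l])
  refine tendsto_zero_of_le_mul_add hq0 hq1 (fun n => apply_nonneg N _)
    (v := fun n => M * (w n * (|β n| * ∑ j ∈ Finset.range n, |β j|))
      + C * N l * |w n * (σ n - s)|) ?_ ?_
  · simpa using (hb.const_mul M).add (hσw.abs.const_mul (C * N l))
  · intro n
    -- Both sequences see the same noise, so only the memory term and the discrepancy `σ n - s`
    -- force the difference; the weighted hypotheses make both tend to zero.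
    have e1 : Z (n + 1) - G (n + 1)
        = A (Z n - G n) + β n • A (W n) + ((σ n - s) * e n) • l := by
      rw [hZ, hG, map_sub, sub_mul, sub_smul]
      abel
    have h1 : N (β n • A (W n)) ≤ M * (w n * (|β n| * ∑ j ∈ Finset.range n, |β j|)) := by
      rw [map_smul_eq_mul, Real.norm_eq_abs]
      have h2 : N (A (W n)) ≤ (∑ j ∈ Finset.range n, |β j|) * (M * w n) := by
        refine (hA _).trans (le_trans ?_ (seminorm_sum_le N hW0 hW n _ fun j hj =>
          (hM j).trans (mul_le_mul_of_nonneg_left (hw hj.le) hM0)))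
        nlinarith [apply_nonneg N (W n)]
      have := mul_le_mul_of_nonneg_left h2 (abs_nonneg (β n))
      linarith
    have h3 : N (((σ n - s) * e n) • l) ≤ C * N l * |w n * (σ n - s)| := by
      rw [map_smul_eq_mul, Real.norm_eq_abs, abs_mul, abs_mul, abs_of_nonneg (hw0 n)]
      have := mul_le_mul_of_nonneg_right
        (mul_le_mul_of_nonneg_left (he n) (abs_nonneg (σ n - s))) (apply_nonneg N l)
      linarith
    rw [e1]
    have h5 := (map_add_le_add N (A (Z n - G n) + β n • A (W n)) (((σ n - s) * e n) • l)).trans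
      (add_le_add_left (map_add_le_add N _ _) _)
    have h6 := hA (Z n - G n)
    linarith

end Stability

/-! ### Adapted norm for a matrix of spectral radius below one. -/

section Lyapunov

attribute [local instance] Matrix.linftyOpNormedRing Matrix.linftyOpNormedAlgebra

variable {p : ℕ}

/-- Gelfand's formula for a real matrix. -/
lemma exists_pow_norm_le (A : Matrix (Fin p) (Fin p) ℝ)
    (hA : spectralRadius ℂ (A.map Complex.ofReal) < 1) :
    ∃ q : ℝ, 0 < q ∧ q < 1 ∧ ∃ m : ℕ, 0 < m ∧ ∀ x, ‖(A ^ m).mulVec x‖ ≤ q ^ m * ‖x‖ := by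
  obtain ⟨q, hq1, hq2⟩ := ENNReal.lt_iff_exists_nnreal_btwn.1 hA
  have hlim := spectrum.pow_nnnorm_pow_one_div_tendsto_nhds_spectralRadius (A.map Complex.ofReal)
  have hq0 : 0 < q := by
    have : (0 : ℝ≥0∞) < q := lt_of_le_of_lt bot_le hq1
    exact_mod_cast this
  obtain ⟨m, hm, hm0⟩ := ((hlim.eventually (gt_mem_nhds hq1)).and (eventually_gt_atTop 0)).exists
  refine ⟨q, hq0, by exact_mod_cast hq2, m, hm0, fun x => ?_⟩
  have h1 : ‖(A.map Complex.ofReal) ^ m‖₊ ≤ q ^ m := by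
    have hm' : (0 : ℝ) < m := by exact_mod_cast hm0
    have h2 := ENNReal.rpow_le_rpow hm.le hm'.le
    rw [← ENNReal.rpow_mul, one_div, inv_mul_cancel₀ hm'.ne', ENNReal.rpow_one,
      ENNReal.rpow_natCast] at h2
    exact_mod_cast h2
  have h3 : (A.map Complex.ofReal) ^ m = (A ^ m).map Complex.ofReal :=
    (Matrix.map_pow (f := Complex.ofRealHom) A m).symm
  have h4 : ‖A ^ m‖ ≤ q ^ m := by
    rw [h3] at h1
    have h5 : ‖(A ^ m).map Complex.ofReal‖ = ‖A ^ m‖ := by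
      rw [Matrix.linfty_opNorm_def, Matrix.linfty_opNorm_def]
      simp
    rw [← h5]
    exact_mod_cast h1
  exact (Matrix.linfty_opNorm_mulVec _ _).trans (mul_le_mul_of_nonneg_right h4 (norm_nonneg _))

/-- An adapted norm for which a matrix of spectral radius less than one is a contraction. -/
lemma exists_adapted_seminorm (A : Matrix (Fin p) (Fin p) ℝ)
    (hA : spectralRadius ℂ (A.map Complex.ofReal) < 1) :
    ∃ (N : Seminorm ℝ (Fin p → ℝ)) (q : ℝ), 0 ≤ q ∧ q < 1 ∧ (∀ x, N (A.mulVec x) ≤ q * N x) ∧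
      ∀ x, ‖x‖ ≤ N x := by
  obtain ⟨q, hq0, hq1, m, hm, h⟩ := exists_pow_norm_le A hA
  -- Summing `q⁻ᵏ ‖Aᵏ x‖` over `k < m` gives contraction by `q`: applying `A` shifts the index, and
  -- the new last term `f m` is at most the lost term `f 0` by Gelfand's bound.
  let f : ℕ → (Fin p → ℝ) → ℝ := fun k x => q⁻¹ ^ k * ‖(A ^ k).mulVec x‖
  let N : Seminorm ℝ (Fin p → ℝ) := Seminorm.of (fun x => ∑ k ∈ Finset.range m, f k x)
    (fun x y => by
      rw [← Finset.sum_add_distrib]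
      refine Finset.sum_le_sum fun k _ => ?_
      simp only [f]
      rw [← mul_add, Matrix.mulVec_add]
      exact mul_le_mul_of_nonneg_left (norm_add_le _ _) (by positivity))
    (fun a x => by
      rw [Finset.mul_sum]
      refine Finset.sum_congr rfl fun k _ => ?_
      simp only [f]
      rw [Matrix.mulVec_smul, norm_smul]
      ring)
  have hN : ∀ x, N x = ∑ k ∈ Finset.range m, f k x := fun x => rfl
  have hf0 : ∀ k x, 0 ≤ f k x := fun k x => by simp only [f]; positivity
  refine ⟨N, q, hq0.le, hq1, fun x => ?_, fun x => ?_⟩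
  · rw [hN, hN]
    have h1 : ∀ k, f k (A.mulVec x) = q * f (k + 1) x := by
      intro k
      simp only [f]
      rw [Matrix.mulVec_mulVec, ← pow_succ, pow_succ q⁻¹]
      linear_combination (-(q⁻¹ ^ k * ‖(A ^ (k + 1)).mulVec x‖)) * mul_inv_cancel₀ hq0.ne'
    simp only [h1]
    rw [← Finset.mul_sum]
    refine mul_le_mul_of_nonneg_left ?_ hq0.le
    have h2 := Finset.sum_range_succ (fun k => f k x) m
    rw [Finset.sum_range_succ'] at h2
    have h3 : f m x ≤ f 0 x := by
      simp only [f, pow_zero, one_mul, Matrix.one_mulVec]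
      rw [inv_pow, inv_mul_le_iff₀ (pow_pos hq0 m)]
      exact h x
    linarith
  · rw [hN]
    have := Finset.single_le_sum (f := fun k => f k x) (fun k _ => hf0 k x) (Finset.mem_range.2 hm)
    simpa [f] using this

end Lyapunov

/-! ### Polynomial weights and almost sure growth of Gaussian variables. -/

section Growth

/-- The weight `(n + 1) ^ δ`. -/
noncomputable def weight (δ : ℝ) (n : ℕ) : ℝ := ((n : ℝ) + 1) ^ δ

lemma weight_monotone {δ : ℝ} (hδ : 0 ≤ δ) : Monotone (weight δ) := fun m n h =>
  Real.rpow_le_rpow (by positivity) (by exact_mod_cast Nat.add_le_add_right h 1) hδ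

lemma one_le_weight {δ : ℝ} (hδ : 0 ≤ δ) (n : ℕ) : 1 ≤ weight δ n :=
  Real.one_le_rpow (by linarith [(Nat.cast_nonneg n : (0 : ℝ) ≤ n)]) hδ

lemma weight_isBigO {δ : ℝ} (hδ : 0 ≤ δ) : weight δ =O[atTop] fun n : ℕ => (n : ℝ) ^ δ := by
  refine IsBigO.of_bound (2 ^ δ) ?_
  filter_upwards [eventually_ge_atTop 1] with n hn
  have hn' : (1 : ℝ) ≤ n := by exact_mod_cast hn
  rw [Real.norm_of_nonneg (by unfold weight; positivity), Real.norm_of_nonneg (by positivity),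
    weight, ← Real.mul_rpow (by norm_num) (by positivity)]
  exact Real.rpow_le_rpow (by positivity) (by linarith) hδ

lemma summable_weight_mul {b : ℕ → ℝ} {α δ : ℝ} (hδ : 0 ≤ δ) (hαδ : 1 < α - δ)
    (hb : b =O[atTop] fun n : ℕ => (n : ℝ) ^ (-α)) : Summable fun n => weight δ n * b n := by
  refine summable_of_isBigO_nat (Real.summable_nat_rpow.2 (show -(α - δ) < -1 by linarith)) ?_
  refine ((weight_isBigO hδ).mul hb).trans (IsBigO.of_bound 1 ?_)
  filter_upwards [eventually_ge_atTop 1] with n hn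
  have hn' : (0 : ℝ) < n := by exact_mod_cast hn
  rw [← Real.rpow_add hn', one_mul, show δ + -α = -(α - δ) by ring]

/-- By Cauchy–Schwarz `(∑_{j<n} |β j|)² ≤ n S`, so the square of the expression is `O(n^{2δ + 1 -
α})`, with negative exponent. -/
lemma tendsto_weight_mul_sum {β : ℕ → ℝ} {α δ : ℝ} (hδ : 0 ≤ δ) (hαδ : 1 + 2 * δ < α)
    (hb : (fun n => β n ^ 2) =O[atTop] fun n : ℕ => (n : ℝ) ^ (-α))
    (hs : Summable fun n => β n ^ 2) :
    Tendsto (fun n => weight δ n * (|β n| * ∑ j ∈ Finset.range n, |β j|)) atTop (𝓝 0) := by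
  set S := ∑' n, β n ^ 2
  have hsq : ∀ n : ℕ, (∑ j ∈ Finset.range n, |β j|) ^ 2 ≤ n * S := by
    intro n
    have h1 := sq_sum_le_card_mul_sum_sq (s := Finset.range n) (f := fun j => |β j|)
    simp only [sq_abs, Finset.card_range] at h1
    exact h1.trans (mul_le_mul_of_nonneg_left (hs.sum_le_tsum _ fun _ _ => sq_nonneg _)
      (Nat.cast_nonneg n))
  have hO : (fun n : ℕ => weight δ n ^ 2 * (β n ^ 2 * (n * S)))
      =O[atTop] fun n : ℕ => (n : ℝ) ^ (-(α - 1 - 2 * δ)) := by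
    have h1 : (fun n : ℕ => (n : ℝ) * S) =O[atTop] fun n : ℕ => (n : ℝ) :=
      (isBigO_refl _ _).mul (isBigO_const_const S one_ne_zero _) |>.congr_right (by simp)
    refine (((weight_isBigO hδ).pow 2).mul (hb.mul h1)).trans (IsBigO.of_bound 1 ?_)
    filter_upwards [eventually_ge_atTop 1] with n hn
    have hn' : (0 : ℝ) < n := by exact_mod_cast hn
    rw [one_mul]
    refine le_of_eq (congrArg norm ?_)
    rw [← Real.rpow_natCast, ← Real.rpow_mul hn'.le]
    nth_rewrite 3 [← Real.rpow_one (n : ℝ)]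
    rw [← Real.rpow_add hn', ← Real.rpow_add hn']
    congr 1
    push_cast
    ring
  have hlim : Tendsto (fun n : ℕ => weight δ n ^ 2 * (β n ^ 2 * (n * S))) atTop (𝓝 0) :=
    hO.trans_tendsto ((tendsto_rpow_neg_atTop (by linarith)).comp tendsto_natCast_atTop_atTop)
  have hsqlim : Tendsto (fun n =>
      (weight δ n * (|β n| * ∑ j ∈ Finset.range n, |β j|)) ^ 2) atTop (𝓝 0) := by
    refine tendsto_of_tendsto_of_tendsto_of_le_of_le tendsto_const_nhds hlim
      (fun n => sq_nonneg _) fun n => ?_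
    beta_reduce
    rw [mul_pow, mul_pow, sq_abs]
    gcongr
    exact hsq n
  have := hsqlim.sqrt
  simp only [Real.sqrt_sq_eq_abs, Real.sqrt_zero] at this
  exact (tendsto_zero_iff_abs_tendsto_zero _).2 this

variable {Ω : Type*} [MeasurableSpace Ω] {P : Measure Ω}

/-- Standard Gaussian variables grow slower than any power of the index. -/
lemma ae_exists_le_weight {e : ℕ → Ω → ℝ} (he : ∀ n, HasLaw (e n) (gaussianReal 0 1) P) {δ : ℝ}
    (hδ : 0 < δ) : ∀ᵐ ω ∂P, ∃ C, ∀ n, |e n ω| ≤ C * weight δ n := by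
  -- With `δ k > 1`, the `k`-th moments of `|e n| / weight δ n` are summable, so the sum of these
  -- powers is almost surely finite.
  obtain ⟨k, hk⟩ := exists_nat_gt (1 / δ)
  have hkδ : 1 < δ * k := by rwa [div_lt_iff₀' hδ] at hk
  have hk0 : k ≠ 0 := by rintro rfl; simp at hkδ; linarith
  have hw0 : ∀ n, 0 < weight δ n := fun n => zero_lt_one.trans_le (one_le_weight hδ.le n)
  set c := ∫⁻ x, ‖x‖ₑ ^ k ∂(gaussianReal 0 1) with hc
  have hcfin : c ≠ ∞ := by
    have h := (memLp_id_gaussianReal (μ := 0) (v := 1) (k : NNReal)).eLpNorm_lt_top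
    rw [eLpNorm_lt_top_iff_lintegral_rpow_enorm_lt_top (by simpa using hk0) (by simp)] at h
    refine ne_of_lt (lt_of_eq_of_lt ?_ h)
    simp [hc]
  have hterm : ∀ n, ∫⁻ ω, (‖e n ω‖ₑ / ENNReal.ofReal (weight δ n)) ^ k ∂P
      = c * ENNReal.ofReal (weight δ n ^ (-(k : ℝ))) := by
    intro n
    have h1 : ∫⁻ ω, ‖e n ω‖ₑ ^ k ∂P = c := by
      rw [hc, ← (he n).map_eq, lintegral_map' (by fun_prop) (he n).aemeasurable]
    have h2 : ∀ ω, (‖e n ω‖ₑ / ENNReal.ofReal (weight δ n)) ^ k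
        = ‖e n ω‖ₑ ^ k * ENNReal.ofReal (weight δ n ^ (-(k : ℝ))) := by
      intro ω
      rw [div_eq_mul_inv, mul_pow, Real.rpow_neg (hw0 n).le, Real.rpow_natCast,
        ENNReal.ofReal_inv_of_pos (pow_pos (hw0 n) k), ENNReal.ofReal_pow (hw0 n).le,
        ENNReal.inv_pow]
    simp only [h2]
    rw [lintegral_mul_const'' _ ((he n).aemeasurable.enorm.pow_const k), h1]
  have hsum : Summable fun n => weight δ n ^ (-(k : ℝ)) := by
    have h := (summable_nat_add_iff 1).2 (Real.summable_nat_rpow.2 (show -(δ * k) < -1 by linarith))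
    refine h.congr fun n => ?_
    rw [weight, ← Real.rpow_mul (by positivity)]
    push_cast
    congr 1
    ring
  have hfin : ∫⁻ ω, ∑' n, (‖e n ω‖ₑ / ENNReal.ofReal (weight δ n)) ^ k ∂P ≠ ∞ := by
    rw [lintegral_tsum fun n => by
      exact (((he n).aemeasurable.enorm.div_const _).pow_const k)]
    simp only [hterm]
    rw [ENNReal.tsum_mul_left, ← ENNReal.ofReal_tsum_of_nonneg
      (fun n => Real.rpow_nonneg (hw0 n).le _) hsum]
    exact ENNReal.mul_ne_top hcfin ENNReal.ofReal_ne_top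
  have hae := ae_lt_top' (AEMeasurable.tsum fun n =>
    (((he n).aemeasurable.enorm.div_const _).pow_const k)) hfin
  filter_upwards [hae] with ω hω
  have hle : ∀ n, (‖e n ω‖ₑ / ENNReal.ofReal (weight δ n)) ^ k
      ≤ ∑' n, (‖e n ω‖ₑ / ENNReal.ofReal (weight δ n)) ^ k := fun n => ENNReal.le_tsum n
  set T := ∑' n, (‖e n ω‖ₑ / ENNReal.ofReal (weight δ n)) ^ k
  -- The extra `1` ensures that a ratio violating the bound exceeds `1`, hence is at most its `k`-th
  -- power, itself at most `T`.
  refine ⟨T.toReal + 1, fun n => ?_⟩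
  have h1 := ENNReal.toReal_mono hω.ne (hle n)
  rw [ENNReal.toReal_pow, ENNReal.toReal_div, toReal_enorm, ENNReal.toReal_ofReal (hw0 n).le,
    Real.norm_eq_abs] at h1
  rw [← div_le_iff₀ (hw0 n)]
  by_contra! hlt
  have hT : 0 ≤ T.toReal := ENNReal.toReal_nonneg
  have h2 : |e n ω| / weight δ n ≤ (|e n ω| / weight δ n) ^ k :=
    le_self_pow₀ (by linarith) hk0
  linarith

end Growth

/-! ### Almost sure convergence to the limiting autoregression. -/

section Convergence

variable {Ω : Type*} [MeasurableSpace Ω] {P : Measure Ω} [IsProbabilityMeasure P] {ξ : ℕ → Ω → ℝ}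
  {p : ℕ}

lemma IsStationaryGaussianNoise.tendsto_zetaFirst_sub_limitAR
    (hξ : IsStationaryGaussianNoise ξ P) (hr : IsNondegenerate (autocov ξ P)) (θ : Fin p → ℝ)
    (hA : spectralRadius ℂ ((companion θ).map Complex.ofReal) < 1) {α : ℝ} (hα : 1 < α)
    (hβ : (fun n : ℕ => pacf ξ P n ^ 2) =O[atTop] fun n : ℕ => (n : ℝ) ^ (-α))
    (γ₀ : Ω → Fin p → ℝ) :
    ∀ᵐ ω ∂P, Tendsto (fun n => zetaFirst θ ξ P n ω - limitAR θ ξ P γ₀ n ω) atTop (𝓝 0) := by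
  obtain ⟨N, q, hq0, hq1, hN, hN1⟩ := exists_adapted_seminorm _ hA
  -- This choice meets both requirements `1 < α - δ` (weighted summability) and `1 + 2 * δ < α`
  -- (memory term).
  set δ := (α - 1) / 4 with hδ
  have hδ0 : 0 < δ := by rw [hδ]; linarith
  have hwsum : Summable fun n => weight δ n * pacf ξ P n ^ 2 :=
    summable_weight_mul hδ0.le (by rw [hδ]; linarith) hβ
  have hsum : Summable fun n => pacf ξ P n ^ 2 :=
    hwsum.of_nonneg_of_le (fun n => sq_nonneg _) fun n =>
      le_mul_of_one_le_left (sq_nonneg _) (one_le_weight hδ0.le n)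
  obtain ⟨-, hσ, hrate⟩ := hξ.tendsto_sigma hr hsum
  have hw0 : ∀ n, 0 ≤ weight δ n := fun n => zero_le_one.trans (one_le_weight hδ0.le n)
  have hσw := hrate (weight δ) (weight_monotone hδ0.le) hw0
    (((summable_nat_add_iff 1).2 hwsum).of_nonneg_of_le
      (fun n => mul_nonneg (hw0 n) (sq_nonneg _)) fun n =>
      mul_le_mul_of_nonneg_right (weight_monotone hδ0.le n.le_succ) (sq_nonneg _))
  have hb := tendsto_weight_mul_sum (δ := δ) hδ0.le (by rw [hδ]; linarith) hβ hsum
  filter_upwards [ae_exists_le_weight (fun n => hξ.hasLaw_eps hr n) hδ0] with ω ⟨K, hK⟩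
  have hlim := tendsto_seminorm_sub N (A := (companion θ).mulVecLin) hq0 hq1 hN
    (weight_monotone hδ0.le) (one_le_weight hδ0.le) hb
    ((tendsto_add_atTop_iff_nat 1).2 hσ) hσw hK (firstVec p)
    (Z := fun n => zetaFirst θ ξ P n ω) (W := fun n i => zeta θ ξ P n ω (Sum.inr i))
    (G := fun n => limitAR θ ξ P γ₀ n ω) ?_ ?_ ?_ (fun n => rfl)
  · exact squeeze_zero_norm (fun n => hN1 _) hlim
  · rfl
  all_goals
    intro n
    have h1 : zeta θ ξ P n ω
        = Sum.elim (zetaFirst θ ξ P n ω) (fun i => zeta θ ξ P n ω (Sum.inr i)) := by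
      ext (i | i) <;> rfl
    have h2 := zeta_succ (ξ := ξ) (P := P) θ n ω
    rw [h1, blockTransition_mulVec] at h2
    ext i
  · simpa [firstVec₂] using congrFun h2 (Sum.inr i)
  · simpa [firstVec₂, zetaFirst] using congrFun h2 (Sum.inl i)

end Convergence

/-! ### I.i.d. Gaussian sequences and removal of their first term. -/

section Sequences

/-- The law of a sequence of independent standard Gaussian variables. -/
noncomputable abbrev gaussSeq : Measure (ℕ → ℝ) := Measure.infinitePi fun _ : ℕ => gaussianReal 0 1

/-- Put a new value at the head of a sequence. -/
def seqCons (z : ℝ × (ℕ → ℝ)) : ℕ → ℝ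
  | 0 => z.1
  | n + 1 => z.2 n

/-- The cylinder of sequences whose first `n` terms lie in prescribed sets. -/
def headCylinder (n : ℕ) (t : ℕ → Set ℝ) : Set (ℕ → ℝ) := {e | ∀ i < n, e i ∈ t i}

lemma measurable_shift {E : Type*} [MeasurableSpace E] : Measurable (shift : (ℕ → E) → ℕ → E) :=
  measurable_pi_lambda _ fun n => measurable_pi_apply (n + 1)

lemma measurable_seqCons : Measurable seqCons := by
  refine measurable_pi_lambda _ fun n => ?_
  cases n with
  | zero => exact measurable_fst
  | succ n => exact (measurable_pi_apply n).comp measurable_snd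

lemma measurableSet_headCylinder {n : ℕ} {t : ℕ → Set ℝ} (ht : ∀ i, MeasurableSet (t i)) :
    MeasurableSet (headCylinder n t) := by
  have : headCylinder n t = ⋂ i, ⋂ (_ : i < n), (fun e : ℕ → ℝ => e i) ⁻¹' t i := by
    ext e; simp [headCylinder]
  rw [this]
  exact MeasurableSet.iInter fun i => MeasurableSet.iInter fun _ => measurable_pi_apply i (ht i)

lemma seqCons_preimage_headCylinder (n : ℕ) (t : ℕ → Set ℝ) :
    seqCons ⁻¹' headCylinder (n + 1) t = t 0 ×ˢ headCylinder n (fun i => t (i + 1)) := by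
  ext z
  simp only [Set.mem_preimage, headCylinder, Set.mem_ofPred_eq, Set.mem_prod]
  constructor
  · exact fun h => ⟨h 0 (by lia), fun i hi => h (i + 1) (by lia)⟩
  · rintro ⟨h0, h1⟩ (_ | i) hi
    · exact h0
    · exact h1 i (by lia)

/-- Padding with `Set.univ` reduces arbitrary finite index sets to initial segments, from which
coordinates can be peeled off one at a time. -/
lemma exists_pi_eq_headCylinder (s : Finset ℕ) (t : ℕ → Set ℝ) (ht : ∀ i, MeasurableSet (t i)) :
    ∃ (n : ℕ) (u : ℕ → Set ℝ), (∀ i, MeasurableSet (u i)) ∧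
      Set.pi (s : Set ℕ) t = headCylinder (n + 1) u ∧
      ∏ i ∈ s, gaussianReal 0 1 (t i) = ∏ i ∈ Finset.range (n + 1), gaussianReal 0 1 (u i) := by
  classical
  have hs : ∀ i ∈ s, i < s.sup id + 1 := fun i hi =>
    Nat.lt_succ_of_le (Finset.le_sup (f := id) hi)
  refine ⟨s.sup id, fun i => if i ∈ s then t i else Set.univ, fun i => ?_, ?_, ?_⟩
  · beta_reduce
    split_ifs
    exacts [ht i, MeasurableSet.univ]
  · ext e
    simp only [Set.mem_pi, Finset.mem_coe, headCylinder, Set.mem_ofPred_eq]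
    constructor
    · intro h i _
      split_ifs with his
      exacts [h i his, Set.mem_univ _]
    · intro h i hi
      have := h i (hs i hi)
      rwa [if_pos hi] at this
  · rw [← Finset.prod_subset (fun i hi => Finset.mem_range.2 (hs i hi))]
    · exact Finset.prod_congr rfl fun i hi => by simp [hi]
    · intro i _ hi
      simp [hi]

lemma gaussSeq_headCylinder (n : ℕ) {t : ℕ → Set ℝ} (ht : ∀ i, MeasurableSet (t i)) :
    gaussSeq (headCylinder n t) = ∏ i ∈ Finset.range n, gaussianReal 0 1 (t i) := by
  rw [← Measure.infinitePi_pi (μ := fun _ : ℕ => gaussianReal 0 1) fun i _ => ht i]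
  congr 1
  ext e
  simp [headCylinder]

lemma measurePreserving_seqCons :
    MeasurePreserving seqCons ((gaussianReal 0 1).prod gaussSeq) gaussSeq := by
  refine ⟨measurable_seqCons, Measure.eq_infinitePi _ fun s t ht => ?_⟩
  obtain ⟨n, u, hu, h1, h2⟩ := exists_pi_eq_headCylinder s t ht
  rw [h1, h2, Measure.map_apply measurable_seqCons (measurableSet_headCylinder hu),
    seqCons_preimage_headCylinder, Measure.prod_prod, gaussSeq_headCylinder _ fun i => hu (i + 1),
    Finset.prod_range_succ', mul_comm]

lemma measurePreserving_uncons : MeasurePreserving (fun e : ℕ → ℝ => (e 0, shift e)) gaussSeq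
    ((gaussianReal 0 1).prod gaussSeq) := by
  have hm : Measurable fun e : ℕ → ℝ => (e 0, shift e) :=
    (measurable_pi_apply 0).prodMk measurable_shift
  refine ⟨hm, ?_⟩
  conv_lhs => rw [← measurePreserving_seqCons.map_eq, Measure.map_map hm measurable_seqCons]
  exact Measure.map_id

lemma gaussSeq_ext {ν₁ ν₂ : Measure (ℕ → ℝ)} [IsFiniteMeasure ν₁]
    (h : ∀ n t, (∀ i, MeasurableSet (t i)) → ν₁ (headCylinder n t) = ν₂ (headCylinder n t)) :
    ν₁ = ν₂ := by
  refine ext_of_generate_finite _ generateFrom_squareCylinders.symm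
    (isPiSystem_squareCylinders (fun _ => MeasurableSpace.isPiSystem_measurableSet)
      fun _ => by simp) ?_ ?_
  · rintro _ ⟨s, t, ht, rfl⟩
    obtain ⟨n, u, hu, h1, -⟩ := exists_pi_eq_headCylinder s t fun i => ht i (Set.mem_univ i)
    rw [h1, h _ _ hu]
  · have := h 0 (fun _ => Set.univ) fun _ => MeasurableSet.univ
    simpa [headCylinder] using this

end Sequences

/-! ### Paths of the autoregression and their coupling. -/

section Path

variable {p : ℕ} (A : Matrix (Fin p) (Fin p) ℝ) (s : ℝ)

/-- One step of the autoregression. -/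
def arStep (z : (Fin p → ℝ) × ℝ) : Fin p → ℝ := A.mulVec z.1 + (s * z.2) • firstVec p

/-- The path of the autoregression started at `x` and driven by `e`. -/
def arPath (x : Fin p → ℝ) (e : ℕ → ℝ) : ℕ → Fin p → ℝ
  | 0 => x
  | n + 1 => arStep A s (arPath x e n, e n)

/-- The skew product generating the paths of the autoregression. -/
def arSkew (z : (Fin p → ℝ) × (ℕ → ℝ)) : (Fin p → ℝ) × (ℕ → ℝ) :=
  (arStep A s (z.1, z.2 0), shift z.2)

lemma continuous_arStep : Continuous (arStep A s) := by
  unfold arStep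
  fun_prop

lemma measurable_arStep : Measurable (arStep A s) := (continuous_arStep A s).measurable

lemma measurable_arPath (n : ℕ) :
    Measurable fun z : (Fin p → ℝ) × (ℕ → ℝ) => arPath A s z.1 z.2 n := by
  induction n with
  | zero => exact measurable_fst
  | succ n ih =>
    exact (measurable_arStep A s).comp
      (ih.prodMk ((measurable_pi_apply n).comp measurable_snd))

/-- This is the semiconjugacy between the skew product and the shift on paths. -/
lemma arPath_succ (x : Fin p → ℝ) (e : ℕ → ℝ) (n : ℕ) :
    arPath A s x e (n + 1) = arPath A s (arStep A s (x, e 0)) (shift e) n := by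
  induction n with
  | zero => rfl
  | succ n ih => rw [arPath, ih]; rfl

lemma arPath_sub (x y : Fin p → ℝ) (e : ℕ → ℝ) (n : ℕ) :
    arPath A s x e n - arPath A s y e n = (A ^ n).mulVec (x - y) := by
  induction n with
  | zero => simp [arPath]
  | succ n ih =>
    rw [arPath, arPath, arStep, arStep, add_sub_add_right_eq_sub, ← Matrix.mulVec_sub, ih,
      Matrix.mulVec_mulVec, pow_succ']

variable {A s}

lemma exists_norm_pow_mulVec_le (hA : spectralRadius ℂ (A.map Complex.ofReal) < 1)
    (x : Fin p → ℝ) :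
    ∃ q C : ℝ, 0 ≤ q ∧ q < 1 ∧ ∀ n, ‖(A ^ n).mulVec x‖ ≤ q ^ n * C := by
  obtain ⟨N, q, hq0, hq1, hN, hN1⟩ := exists_adapted_seminorm A hA
  refine ⟨q, N x, hq0, hq1, fun n => (hN1 _).trans ?_⟩
  induction n with
  | zero => simp
  | succ n ih =>
    rw [pow_succ', ← Matrix.mulVec_mulVec, pow_succ', mul_assoc]
    exact (hN _).trans (mul_le_mul_of_nonneg_left ih hq0)

lemma tendsto_pow_mulVec (hA : spectralRadius ℂ (A.map Complex.ofReal) < 1) (x : Fin p → ℝ) :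
    Tendsto (fun n => (A ^ n).mulVec x) atTop (𝓝 0) := by
  obtain ⟨q, C, hq0, hq1, h⟩ := exists_norm_pow_mulVec_le hA x
  refine squeeze_zero_norm h ?_
  simpa using (tendsto_pow_atTop_nhds_zero_of_lt_one hq0 hq1).mul_const C

/-- Paths driven by the same noise merge, in the mean, along bounded uniformly continuous
functions. -/
lemma tendsto_lintegral_arPath_sub (hA : spectralRadius ℂ (A.map Complex.ofReal) < 1)
    {F : Type*} [NormedAddCommGroup F] [MeasurableSpace F] [BorelSpace F]
    [SecondCountableTopology F]
    {f : (Fin p → ℝ) → F} (hf : UniformContinuous f) {M : ℝ} (hM : ∀ x, ‖f x‖ ≤ M)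
    (μ₁ μ₂ : Measure (Fin p → ℝ)) [IsProbabilityMeasure μ₁] [IsProbabilityMeasure μ₂] :
    Tendsto (fun n => ∫⁻ z, ‖f (arPath A s z.1.1 z.2 n) - f (arPath A s z.1.2 z.2 n)‖ₑ
      ∂((μ₁.prod μ₂).prod gaussSeq)) atTop (𝓝 0) := by
  have hmeas : ∀ n, Measurable fun z : ((Fin p → ℝ) × (Fin p → ℝ)) × (ℕ → ℝ) =>
      ‖f (arPath A s z.1.1 z.2 n) - f (arPath A s z.1.2 z.2 n)‖ₑ := by
    intro n
    have h1 : Measurable fun z : ((Fin p → ℝ) × (Fin p → ℝ)) × (ℕ → ℝ) =>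
        arPath A s z.1.1 z.2 n :=
      (measurable_arPath A s n).comp ((measurable_fst.comp measurable_fst).prodMk measurable_snd)
    have h2 : Measurable fun z : ((Fin p → ℝ) × (Fin p → ℝ)) × (ℕ → ℝ) =>
        arPath A s z.1.2 z.2 n :=
      (measurable_arPath A s n).comp ((measurable_snd.comp measurable_fst).prodMk measurable_snd)
    exact ((hf.continuous.measurable.comp h1).sub (hf.continuous.measurable.comp h2)).enorm
  have h0 : (0 : ℝ≥0∞) = ∫⁻ _z, 0 ∂((μ₁.prod μ₂).prod gaussSeq) := by simp
  rw [h0]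
  refine tendsto_lintegral_of_dominated_convergence (fun _ => ENNReal.ofReal (M + M)) hmeas
    (fun n => ae_of_all _ fun z => ?_) (by simp) (ae_of_all _ fun z => ?_)
  · beta_reduce
    rw [← ofReal_norm]
    exact ENNReal.ofReal_le_ofReal ((norm_sub_le _ _).trans (add_le_add (hM _) (hM _)))
  · have h1 : Tendsto (fun n => dist (arPath A s z.1.1 z.2 n) (arPath A s z.1.2 z.2 n)) atTop
        (𝓝 0) := by
      have := (tendsto_pow_mulVec hA (z.1.1 - z.1.2)).norm
      simp only [norm_zero] at this
      refine this.congr fun n => ?_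
      rw [dist_eq_norm, arPath_sub]
    have h2 : Tendsto (fun n => dist (f (arPath A s z.1.1 z.2 n)) (f (arPath A s z.1.2 z.2 n)))
        atTop (𝓝 0) := by
      rw [Metric.tendsto_atTop]
      intro ε hε
      obtain ⟨δ, hδ, h⟩ := Metric.uniformContinuous_iff.1 hf ε hε
      obtain ⟨n₀, hn₀⟩ := Metric.tendsto_atTop.1 h1 δ hδ
      refine ⟨n₀, fun n hn => ?_⟩
      have h3 := hn₀ n hn
      rw [Real.dist_0_eq_abs, abs_of_nonneg dist_nonneg] at h3 ⊢
      exact h h3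
    have h3 := ENNReal.tendsto_ofReal h2
    rw [ENNReal.ofReal_zero] at h3
    refine h3.congr fun n => ?_
    rw [dist_eq_norm, ofReal_norm]

end Path

/-! ### Existence and uniqueness of the invariant law. -/

section Invariant

variable {p : ℕ} {A : Matrix (Fin p) (Fin p) ℝ} {s : ℝ} {μ : Measure (Fin p → ℝ)}

lemma IsInvariantLaw.measurePreserving_arStep (hμ : IsInvariantLaw A s μ) :
    MeasurePreserving (arStep A s) (μ.prod (gaussianReal 0 1)) μ :=
  ⟨measurable_arStep A s, hμ.2⟩

lemma IsInvariantLaw.measurePreserving_arSkew (hμ : IsInvariantLaw A s μ) :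
    MeasurePreserving (arSkew A s) (μ.prod gaussSeq) (μ.prod gaussSeq) := by
  have := hμ.1
  have h1 := (MeasurePreserving.id μ).prod measurePreserving_uncons
  have h2 := (measurePreserving_prodAssoc μ (gaussianReal 0 1) gaussSeq).symm
  have h3 := hμ.measurePreserving_arStep.prod (MeasurePreserving.id gaussSeq)
  exact h3.comp (h2.comp h1)

lemma IsInvariantLaw.measurePreserving_arPath (hμ : IsInvariantLaw A s μ) (n : ℕ) :
    MeasurePreserving (fun z : (Fin p → ℝ) × (ℕ → ℝ) => arPath A s z.1 z.2 n)
      (μ.prod gaussSeq) μ := by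
  have := hμ.1
  induction n with
  | zero => exact measurePreserving_fst
  | succ n ih =>
    have h := ih.comp hμ.measurePreserving_arSkew
    convert h using 1
    ext1 z
    exact arPath_succ A s z.1 z.2 n

/-- Coupling: start independently from `μ₁` and `μ₂` with common noise. Both marginals are preserved
while the paths merge, so the characteristic functions coincide. -/
lemma IsInvariantLaw.eq (hA : spectralRadius ℂ (A.map Complex.ofReal) < 1)
    {μ₁ μ₂ : Measure (Fin p → ℝ)} (h₁ : IsInvariantLaw A s μ₁) (h₂ : IsInvariantLaw A s μ₂) :
    μ₁ = μ₂ := by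
  have := h₁.1
  have := h₂.1
  refine Measure.ext_of_charFunDual (funext fun L => ?_)
  set f : (Fin p → ℝ) → ℂ := fun x => Complex.exp (L x * Complex.I) with hf
  have hM : ∀ x, ‖f x‖ ≤ 1 := fun x => by
    rw [hf, Complex.norm_exp_ofReal_mul_I]
  have hfu : UniformContinuous f := by
    have hlip : ∀ x y : ℝ, ‖Complex.exp (x * Complex.I) - Complex.exp (y * Complex.I)‖
        ≤ 1 * ‖x - y‖ := by
      intro x y
      have h1 : Complex.exp (x * Complex.I) - Complex.exp (y * Complex.I)
          = Complex.exp (y * Complex.I) * (Complex.exp (Complex.I * ((x - y : ℝ) : ℂ)) - 1) := by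
        rw [mul_sub, ← Complex.exp_add, mul_one]
        congr 2
        push_cast
        ring
      rw [h1, norm_mul, Complex.norm_exp_ofReal_mul_I]
      exact mul_le_mul_of_nonneg_left Real.norm_exp_I_mul_ofReal_sub_one_le zero_le_one
    have h2 : UniformContinuous fun x : ℝ => Complex.exp (x * Complex.I) :=
      (LipschitzWith.of_dist_le_mul (K := 1) fun x y => by
        rw [dist_eq_norm, dist_eq_norm]; exact hlip x y).uniformContinuous
    exact h2.comp L.uniformContinuous
  rw [charFunDual_apply, charFunDual_apply]
  change ∫ x, f x ∂μ₁ = ∫ x, f x ∂μ₂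
  have hlim := tendsto_lintegral_arPath_sub (s := s) hA hfu hM μ₁ μ₂
  have hle : ∀ n, ‖∫ x, f x ∂μ₁ - ∫ x, f x ∂μ₂‖ₑ
      ≤ ∫⁻ z, ‖f (arPath A s z.1.1 z.2 n) - f (arPath A s z.1.2 z.2 n)‖ₑ
        ∂((μ₁.prod μ₂).prod gaussSeq) := by
    intro n
    have p1 : MeasurePreserving (fun z : ((Fin p → ℝ) × (Fin p → ℝ)) × (ℕ → ℝ) =>
        arPath A s z.1.1 z.2 n) ((μ₁.prod μ₂).prod gaussSeq) μ₁ :=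
      (h₁.measurePreserving_arPath n).comp
        (measurePreserving_fst.prod (MeasurePreserving.id gaussSeq))
    have p2 : MeasurePreserving (fun z : ((Fin p → ℝ) × (Fin p → ℝ)) × (ℕ → ℝ) =>
        arPath A s z.1.2 z.2 n) ((μ₁.prod μ₂).prod gaussSeq) μ₂ :=
      (h₂.measurePreserving_arPath n).comp
        (measurePreserving_snd.prod (MeasurePreserving.id gaussSeq))
    have i : ∀ (ν : Measure (Fin p → ℝ)) [IsProbabilityMeasure ν], Integrable f ν := fun ν _ =>
      Integrable.of_bound hfu.continuous.aestronglyMeasurable 1 (ae_of_all _ hM)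
    have e1 : ∫ x, f x ∂μ₁ = ∫ z, f (arPath A s z.1.1 z.2 n) ∂((μ₁.prod μ₂).prod gaussSeq) := by
      rw [← integral_map p1.measurable.aemeasurable
        hfu.continuous.aestronglyMeasurable, p1.map_eq]
    have e2 : ∫ x, f x ∂μ₂ = ∫ z, f (arPath A s z.1.2 z.2 n) ∂((μ₁.prod μ₂).prod gaussSeq) := by
      rw [← integral_map p2.measurable.aemeasurable
        hfu.continuous.aestronglyMeasurable, p2.map_eq]
    have i1 : Integrable (fun z : ((Fin p → ℝ) × (Fin p → ℝ)) × (ℕ → ℝ) =>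
        f (arPath A s z.1.1 z.2 n)) ((μ₁.prod μ₂).prod gaussSeq) :=
      p1.integrable_comp_of_integrable (i μ₁)
    have i2 : Integrable (fun z : ((Fin p → ℝ) × (Fin p → ℝ)) × (ℕ → ℝ) =>
        f (arPath A s z.1.2 z.2 n)) ((μ₁.prod μ₂).prod gaussSeq) :=
      p2.integrable_comp_of_integrable (i μ₂)
    rw [e1, e2, ← integral_sub i1 i2]
    exact enorm_integral_le_lintegral_enorm _
  have h0 : ‖∫ x, f x ∂μ₁ - ∫ x, f x ∂μ₂‖ₑ ≤ 0 :=
    ge_of_tendsto hlim (Eventually.of_forall hle)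
  rw [nonpos_iff_eq_zero, enorm_eq_zero, sub_eq_zero] at h0
  exact h0

/-- The stationary solution as a function of the noise. -/
noncomputable def arSeries (A : Matrix (Fin p) (Fin p) ℝ) (s : ℝ) (e : ℕ → ℝ) : Fin p → ℝ :=
  ∑' k, (s * e k) • (A ^ k).mulVec (firstVec p)

lemma ae_summable_arSeries (hA : spectralRadius ℂ (A.map Complex.ofReal) < 1) :
    ∀ᵐ e ∂gaussSeq, Summable fun k => (s * e k) • (A ^ k).mulVec (firstVec p) := by
  obtain ⟨q, C, hq0, hq1, hpow⟩ := exists_norm_pow_mulVec_le hA (firstVec p)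
  have hlaw : ∀ n : ℕ, HasLaw (fun e : ℕ → ℝ => e n) (gaussianReal 0 1) gaussSeq := fun n =>
    ⟨(measurable_pi_apply n).aemeasurable, Measure.infinitePi_map_eval _ n⟩
  filter_upwards [ae_exists_le_weight hlaw one_pos] with e ⟨K, hK⟩
  have hsum : Summable fun n : ℕ => |s| * K * C * (((n : ℝ) + 1) * q ^ n) := by
    refine Summable.mul_left _ ?_
    have h1 := summable_pow_mul_geometric_of_norm_lt_one (R := ℝ) 1
      (by rwa [Real.norm_of_nonneg hq0] : ‖q‖ < 1)
    have h2 := summable_geometric_of_lt_one hq0 hq1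
    refine (h1.add h2).congr fun n => ?_
    ring
  refine Summable.of_norm_bounded hsum fun n => ?_
  rw [norm_smul, Real.norm_eq_abs, abs_mul]
  have hK' := hK n
  rw [weight, Real.rpow_one] at hK'
  have h3 : |s| * |e n| ≤ |s| * (K * (n + 1)) := mul_le_mul_of_nonneg_left hK' (abs_nonneg s)
  calc |s| * |e n| * ‖(A ^ n).mulVec (firstVec p)‖
      ≤ |s| * (K * (n + 1)) * (q ^ n * C) :=
        mul_le_mul h3 (hpow n) (norm_nonneg _) ((by positivity : (0:ℝ) ≤ |s| * |e n|).trans h3)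
    _ = _ := by ring

/-- Prepending a noise value performs one step of the autoregression. Since `seqCons` preserves
`gaussSeq`, the law of the series is invariant. -/
lemma arSeries_seqCons {a : ℝ} {e : ℕ → ℝ}
    (he : Summable fun k => (s * e k) • (A ^ k).mulVec (firstVec p)) :
    arSeries A s (seqCons (a, e)) = arStep A s (arSeries A s e, a) := by
  have h1 : ∀ k, (s * seqCons (a, e) (k + 1)) • (A ^ (k + 1)).mulVec (firstVec p)
      = A.mulVecLin.toContinuousLinearMap ((s * e k) • (A ^ k).mulVec (firstVec p)) := by
    intro k
    simp only [LinearMap.coe_toContinuousLinearMap', Matrix.mulVecLin_apply]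
    rw [Matrix.mulVec_smul, Matrix.mulVec_mulVec, ← pow_succ']
    rfl
  have hs : Summable fun k => (s * seqCons (a, e) k) • (A ^ k).mulVec (firstVec p) := by
    rw [← summable_nat_add_iff 1]
    simp only [h1]
    exact he.mapL _
  rw [arSeries, hs.tsum_eq_zero_add]
  simp only [h1]
  rw [← ContinuousLinearMap.map_tsum _ he, add_comm]
  simp [arStep, arSeries, seqCons]

lemma exists_isInvariantLaw (hA : spectralRadius ℂ (A.map Complex.ofReal) < 1) :
    ∃ μ, IsInvariantLaw A s μ := by
  have hmeas : AEMeasurable (arSeries A s) gaussSeq := by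
    refine aemeasurable_of_tendsto_metrizable_ae atTop
      (f := fun n e => ∑ k ∈ Finset.range n, (s * e k) • (A ^ k).mulVec (firstVec p))
      (fun n => ?_) ?_
    · refine Measurable.aemeasurable ?_
      fun_prop
    · filter_upwards [ae_summable_arSeries hA] with e he
      exact he.hasSum.tendsto_sum_nat
  set M := hmeas.mk (arSeries A s) with hM
  have hMm : Measurable M := hmeas.measurable_mk
  have hMe : arSeries A s =ᵐ[gaussSeq] M := hmeas.ae_eq_mk
  refine ⟨gaussSeq.map M, Measure.isProbabilityMeasure_map hMm.aemeasurable, ?_⟩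
  have hsnd := (measurePreserving_snd (μ := gaussianReal 0 1) (ν := gaussSeq))
  have hcons : (fun z : ℝ × (ℕ → ℝ) => arStep A s (M z.2, z.1))
      =ᵐ[(gaussianReal 0 1).prod gaussSeq] M ∘ seqCons := by
    filter_upwards [hsnd.quasiMeasurePreserving.ae (ae_summable_arSeries (s := s) hA),
      hsnd.quasiMeasurePreserving.ae hMe,
      measurePreserving_seqCons.quasiMeasurePreserving.ae hMe] with z h1 h2 h3
    rw [Function.comp_apply, ← h3, ← h2]
    exact (arSeries_seqCons h1).symm
  change ((gaussSeq.map M).prod (gaussianReal 0 1)).map (arStep A s) = _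
  have h1 := Measure.map_prod_map gaussSeq (gaussianReal 0 1) hMm measurable_id
  rw [Measure.map_id] at h1
  rw [h1, Measure.map_map (measurable_arStep A s) (hMm.prodMap measurable_id),
    ← Measure.prod_swap, Measure.map_map
      ((measurable_arStep A s).comp (hMm.prodMap measurable_id)) measurable_swap]
  refine (Measure.map_congr hcons).trans ?_
  rw [← Measure.map_map hMm measurable_seqCons, measurePreserving_seqCons.map_eq]

end Invariant

/-! ### Harmonic functions and ergodicity of the skew product. -/

section Ergodic

variable {p : ℕ} {A : Matrix (Fin p) (Fin p) ℝ} {s : ℝ} {μ : Measure (Fin p → ℝ)}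

lemma integrable_of_abs_le {X : Type*} [MeasurableSpace X] {m : Measure X} [IsProbabilityMeasure m]
    {h : X → ℝ} (hm : Measurable h) {M : ℝ} (hM : ∀ x, |h x| ≤ M) : Integrable h m :=
  Integrable.of_bound hm.aestronglyMeasurable M (ae_of_all _ hM)

/-- A harmonic function is the mean of its values along the paths. -/
lemma harmonic_eq_integral_arPath {h : (Fin p → ℝ) → ℝ} (hm : Measurable h) {M : ℝ}
    (hM : ∀ x, |h x| ≤ M) (hh : ∀ y, h y = ∫ a, h (arStep A s (y, a)) ∂(gaussianReal 0 1))
    (n : ℕ) (y : Fin p → ℝ) : h y = ∫ e, h (arPath A s y e n) ∂gaussSeq := by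
  induction n generalizing y with
  | zero => simp [arPath]
  | succ n ih =>
    have hmeas : Measurable fun z : ℝ × (ℕ → ℝ) =>
        h (arPath A s (arStep A s (y, z.1)) z.2 n) :=
      hm.comp ((measurable_arPath A s n).comp
        (((measurable_arStep A s).comp (measurable_const.prodMk measurable_fst)).prodMk
          measurable_snd))
    have h1 : ∫ e, h (arPath A s y e (n + 1)) ∂gaussSeq
        = ∫ z, h (arPath A s (arStep A s (y, z.1)) z.2 n) ∂((gaussianReal 0 1).prod gaussSeq) := by
      rw [← measurePreserving_uncons.map_eq, integral_map
        measurePreserving_uncons.measurable.aemeasurable hmeas.aestronglyMeasurable]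
      simp only [arPath_succ]
    rw [h1, integral_prod _ (integrable_of_abs_le hmeas fun _ => hM _), hh y]
    exact integral_congr_ae (ae_of_all _ fun a => ih _)

/-- Bounded harmonic functions are almost everywhere constant for an invariant law. -/
lemma IsInvariantLaw.harmonic_ae_const (hμ : IsInvariantLaw A s μ)
    (hA : spectralRadius ℂ (A.map Complex.ofReal) < 1)
    {h : (Fin p → ℝ) → ℝ} (hm : Measurable h) {M : ℝ} (hM : ∀ x, |h x| ≤ M)
    (hh : ∀ y, h y = ∫ a, h (arStep A s (y, a)) ∂(gaussianReal 0 1)) :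
    ∃ y₀, ∀ᵐ y ∂μ, h y = h y₀ := by
  have := hμ.1
  set J := ∫⁻ z, ‖h z.1 - h z.2‖ₑ ∂(μ.prod μ) with hJ
  have hJle : ∀ ε : ℝ≥0∞, ε ≠ 0 → J ≤ ε + ε := by
    intro ε hε
    -- The coupling needs uniform continuity, which `h` lacks. Replacing it by `f` costs `ε` for
    -- each path, at every time `n`, because `μ` is invariant.
    obtain ⟨f, hfc, hfε, hfcont, -⟩ := (memLp_one_iff_integrable.2
      (integrable_of_abs_le (m := μ) hm hM)).exists_hasCompactSupport_eLpNorm_sub_le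
        ENNReal.one_ne_top hε
    have hfu : UniformContinuous f :=
      hfcont.uniformContinuous_of_tendsto_cocompact hfc.is_zero_at_infty
    obtain ⟨C, hC⟩ := hfc.exists_bound_of_continuous hfcont
    rw [eLpNorm_one_eq_lintegral_enorm] at hfε
    have hfm : Measurable (h - f) := hm.sub hfcont.measurable
    have hlim := (tendsto_lintegral_arPath_sub (s := s) hA hfu hC μ μ).const_add (ε + ε)
    rw [add_zero] at hlim
    refine ge_of_tendsto hlim (Eventually.of_forall fun n => ?_)
    have m1 : Measurable fun z : ((Fin p → ℝ) × (Fin p → ℝ)) × (ℕ → ℝ) =>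
        arPath A s z.1.1 z.2 n :=
      (measurable_arPath A s n).comp ((measurable_fst.comp measurable_fst).prodMk measurable_snd)
    have m2 : Measurable fun z : ((Fin p → ℝ) × (Fin p → ℝ)) × (ℕ → ℝ) =>
        arPath A s z.1.2 z.2 n :=
      (measurable_arPath A s n).comp ((measurable_snd.comp measurable_fst).prodMk measurable_snd)
    have p1 : MeasurePreserving (fun z : ((Fin p → ℝ) × (Fin p → ℝ)) × (ℕ → ℝ) =>
        arPath A s z.1.1 z.2 n) ((μ.prod μ).prod gaussSeq) μ :=
      (hμ.measurePreserving_arPath n).comp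
        (measurePreserving_fst.prod (MeasurePreserving.id gaussSeq))
    have p2 : MeasurePreserving (fun z : ((Fin p → ℝ) × (Fin p → ℝ)) × (ℕ → ℝ) =>
        arPath A s z.1.2 z.2 n) ((μ.prod μ).prod gaussSeq) μ :=
      (hμ.measurePreserving_arPath n).comp
        (measurePreserving_snd.prod (MeasurePreserving.id gaussSeq))
    have l1 : ∫⁻ z, ‖(h - f) (arPath A s z.1.1 z.2 n)‖ₑ ∂((μ.prod μ).prod gaussSeq) ≤ ε := by
      rw [p1.lintegral_comp (f := fun x => ‖(h - f) x‖ₑ) hfm.enorm]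
      exact hfε
    have l2 : ∫⁻ z, ‖(h - f) (arPath A s z.1.2 z.2 n)‖ₑ ∂((μ.prod μ).prod gaussSeq) ≤ ε := by
      rw [p2.lintegral_comp (f := fun x => ‖(h - f) x‖ₑ) hfm.enorm]
      exact hfε
    calc J ≤ ∫⁻ z, ∫⁻ e, ‖h (arPath A s z.1 e n) - h (arPath A s z.2 e n)‖ₑ ∂gaussSeq
            ∂(μ.prod μ) := by
          refine lintegral_mono fun z => ?_
          beta_reduce
          have hp : ∀ y, Integrable (fun e => h (arPath A s y e n)) gaussSeq := fun y =>
            integrable_of_abs_le (hm.comp ((measurable_arPath A s n).comp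
              (measurable_const.prodMk measurable_id))) fun _ => hM _
          rw [harmonic_eq_integral_arPath hm hM hh n z.1,
            harmonic_eq_integral_arPath hm hM hh n z.2, ← integral_sub (hp _) (hp _)]
          exact enorm_integral_le_lintegral_enorm _
      _ = ∫⁻ z, ‖h (arPath A s z.1.1 z.2 n) - h (arPath A s z.1.2 z.2 n)‖ₑ
            ∂((μ.prod μ).prod gaussSeq) := by
          have hmz : Measurable fun z : ((Fin p → ℝ) × (Fin p → ℝ)) × (ℕ → ℝ) =>
              ‖h (arPath A s z.1.1 z.2 n) - h (arPath A s z.1.2 z.2 n)‖ₑ :=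
            ((hm.comp m1).sub (hm.comp m2)).enorm
          rw [lintegral_prod _ hmz.aemeasurable]
      _ ≤ ∫⁻ z, (‖(h - f) (arPath A s z.1.1 z.2 n)‖ₑ + ‖(h - f) (arPath A s z.1.2 z.2 n)‖ₑ)
            + ‖f (arPath A s z.1.1 z.2 n) - f (arPath A s z.1.2 z.2 n)‖ₑ
            ∂((μ.prod μ).prod gaussSeq) := by
          refine lintegral_mono fun z => ?_
          beta_reduce
          set u := arPath A s z.1.1 z.2 n
          set v := arPath A s z.1.2 z.2 n
          have e1 : h u - h v = ((h - f) u - (h - f) v) + (f u - f v) := by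
            simp only [Pi.sub_apply]; ring
          rw [e1]
          exact (enorm_add_le _ _).trans (add_le_add_left enorm_sub_le _)
      _ = _ := by
          have hm1 : Measurable fun z : ((Fin p → ℝ) × (Fin p → ℝ)) × (ℕ → ℝ) =>
              ‖(h - f) (arPath A s z.1.1 z.2 n)‖ₑ := (hfm.comp m1).enorm
          have hm2 : Measurable fun z : ((Fin p → ℝ) × (Fin p → ℝ)) × (ℕ → ℝ) =>
              ‖(h - f) (arPath A s z.1.2 z.2 n)‖ₑ := (hfm.comp m2).enorm
          exact (lintegral_add_left (hm1.add hm2) _).trans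
            (congrArg (· + _) (lintegral_add_left hm1 _))
      _ ≤ _ := add_le_add_left (add_le_add l1 l2) _
  have hJ0 : J = 0 := by
    by_contra hne
    have hfin : J ≠ ∞ := ne_top_of_le_ne_top (by simp) (hJle 1 one_ne_zero)
    -- With `ε = J / 4` the bound reads `J ≤ J / 2`.
    have h5 := hJle (J / 2 / 2) (by simp [hne])
    rw [ENNReal.add_halves] at h5
    exact absurd h5 (not_le.2 (ENNReal.half_lt_self hne hfin))
  have hae : ∀ᵐ z ∂(μ.prod μ), h z.1 = h z.2 := by
    have hmz : Measurable fun z : (Fin p → ℝ) × (Fin p → ℝ) => ‖h z.1 - h z.2‖ₑ :=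
      ((hm.comp measurable_fst).sub (hm.comp measurable_snd)).enorm
    have := (lintegral_eq_zero_iff hmz).1 hJ0
    filter_upwards [this] with z hz
    rwa [Pi.zero_apply, enorm_eq_zero, sub_eq_zero] at hz
  obtain ⟨y₀, hy₀⟩ := (Measure.ae_ae_of_ae_prod hae).exists
  exact ⟨y₀, hy₀.mono fun y hy => hy.symm⟩

/-- One-step decomposition of the sections of an invariant set. -/
lemma gaussSeq_section_succ {B : Set ((Fin p → ℝ) × (ℕ → ℝ))} (hB : MeasurableSet B)
    (hinv : arSkew A s ⁻¹' B = B) (n : ℕ) {t : ℕ → Set ℝ} (ht : ∀ i, MeasurableSet (t i))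
    (y : Fin p → ℝ) :
    gaussSeq (headCylinder (n + 1) t ∩ Prod.mk y ⁻¹' B)
      = ∫⁻ a in t 0, gaussSeq (headCylinder n (fun i => t (i + 1)) ∩
          Prod.mk (arStep A s (y, a)) ⁻¹' B) ∂(gaussianReal 0 1) := by
  have hmD : MeasurableSet (headCylinder (n + 1) t ∩ Prod.mk y ⁻¹' B) :=
    (measurableSet_headCylinder ht).inter (measurable_prodMk_left hB)
  rw [← measurePreserving_seqCons.measure_preimage hmD.nullMeasurableSet,
    Measure.prod_apply (measurable_seqCons hmD), ← lintegral_indicator (ht 0)]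
  refine lintegral_congr fun a => ?_
  have h1 : ∀ e, (y, seqCons (a, e)) ∈ B ↔ (arStep A s (y, a), e) ∈ B := by
    intro e
    conv_lhs => rw [← hinv]
    rfl
  by_cases ha : a ∈ t 0
  · rw [Set.indicator_of_mem ha]
    congr 1
    ext e
    have h2 := Set.ext_iff.1 (seqCons_preimage_headCylinder n t) (a, e)
    simp only [Set.mem_preimage, Set.mem_inter_iff, Set.mem_prod] at h2 ⊢
    rw [h2, h1]
    simp [ha]
  · rw [Set.indicator_of_notMem ha, ← measure_empty (μ := gaussSeq)]
    congr 1
    ext e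
    have h2 := Set.ext_iff.1 (seqCons_preimage_headCylinder n t) (a, e)
    simp only [Set.mem_preimage, Set.mem_inter_iff, Set.mem_prod] at h2 ⊢
    rw [h2]
    simp [ha]

lemma headCylinder_zero (t : ℕ → Set ℝ) : headCylinder 0 t = Set.univ := by
  ext e; simp [headCylinder]

/-- The section measure of an invariant `B` is harmonic, hence almost everywhere a constant `c`.
Invariance propagates this to `B` being independent of every noise cylinder, so the measure
restricted to `B` is `c` times the whole. Evaluating at `Bᶜ` leaves `c = 0` or `Bᶜ` null. -/
lemma IsInvariantLaw.preErgodic_arSkew (hμ : IsInvariantLaw A s μ)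
    (hA : spectralRadius ℂ (A.map Complex.ofReal) < 1) :
    PreErgodic (arSkew A s) (μ.prod gaussSeq) := by
  have := hμ.1
  refine ⟨fun B hB hinv => ?_⟩
  set H : (Fin p → ℝ) → ℝ≥0∞ := fun y => gaussSeq (Prod.mk y ⁻¹' B) with hH
  have hHm : Measurable H := measurable_measure_prodMk_left hB
  have hH1 : ∀ y, H y ≤ 1 := fun y => prob_le_one
  have hHfin : ∀ y, H y ≠ ∞ := fun y => measure_ne_top _ _
  have hharm : ∀ y, H y = ∫⁻ a, H (arStep A s (y, a)) ∂(gaussianReal 0 1) := by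
    intro y
    have h := gaussSeq_section_succ hB hinv 0 (t := fun _ => Set.univ)
      (fun _ => MeasurableSet.univ) y
    have hu : headCylinder (0 + 1) (fun _ => Set.univ) = Set.univ := by
      ext e; simp [headCylinder]
    rw [hu] at h
    simpa [headCylinder_zero] using h
  obtain ⟨y₀, hy₀⟩ := hμ.harmonic_ae_const (h := fun y => (H y).toReal) hA hHm.ennreal_toReal
    (M := 1) (fun y => by
      rw [abs_of_nonneg ENNReal.toReal_nonneg]
      exact ENNReal.toReal_le_of_le_ofReal zero_le_one (by simpa using hH1 y))
    (fun y => by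
      rw [hharm y, integral_toReal]
      · exact (hHm.comp ((measurable_arStep A s).comp
          (measurable_const.prodMk measurable_id))).aemeasurable
      · exact ae_of_all _ fun a => (hHfin _).lt_top)
  set c := H y₀ with hc
  have hcfin : c ≠ ∞ := hHfin y₀
  have hconst : ∀ᵐ y ∂μ, H y = c := by
    filter_upwards [hy₀] with y hy
    exact (ENNReal.toReal_eq_toReal_iff' (hHfin y) hcfin).1 hy
  have hcyl : ∀ n t, (∀ i, MeasurableSet (t i)) → ∀ᵐ y ∂μ,
      gaussSeq (headCylinder n t ∩ Prod.mk y ⁻¹' B) = c * gaussSeq (headCylinder n t) := by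
    intro n
    induction n with
    | zero =>
      intro t ht
      filter_upwards [hconst] with y hy
      rw [headCylinder_zero, Set.univ_inter, measure_univ, mul_one]
      exact hy
    | succ n ih =>
      intro t ht
      have h1 := hμ.measurePreserving_arStep.quasiMeasurePreserving.ae
        (ih (fun i => t (i + 1)) fun i => ht (i + 1))
      filter_upwards [Measure.ae_ae_of_ae_prod h1] with y hy
      rw [gaussSeq_section_succ hB hinv n ht y, lintegral_congr_ae (ae_restrict_of_ae hy),
        lintegral_const, Measure.restrict_apply_univ, gaussSeq_headCylinder _ ht,
        gaussSeq_headCylinder _ fun i => ht (i + 1), Finset.prod_range_succ', mul_assoc]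
  have hrect : ∀ U D, MeasurableSet U → MeasurableSet D →
      ((μ.prod gaussSeq).restrict B) (U ×ˢ D) = (c • μ) U * gaussSeq D := by
    intro U D hU hD
    -- With `U` fixed, both sides are measures in the noise alone, so agreement on head cylinders
    -- suffices.
    have key : (((μ.prod gaussSeq).restrict B).restrict (U ×ˢ Set.univ)).map Prod.snd
        = (c * μ U) • gaussSeq := by
      refine gaussSeq_ext fun n t ht => ?_
      have hDt := measurableSet_headCylinder (n := n) ht
      rw [Measure.map_apply measurable_snd hDt, Measure.restrict_apply (measurable_snd hDt),
        Measure.restrict_apply ((measurable_snd hDt).inter (hU.prod MeasurableSet.univ)),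
        Measure.prod_apply (((measurable_snd hDt).inter (hU.prod MeasurableSet.univ)).inter hB)]
      have h2 : ∀ᵐ y ∂μ, gaussSeq (Prod.mk y ⁻¹'
          (Prod.snd ⁻¹' headCylinder n t ∩ U ×ˢ Set.univ ∩ B))
          = U.indicator (fun _ => c * gaussSeq (headCylinder n t)) y := by
        filter_upwards [hcyl n t ht] with y hy
        by_cases hyU : y ∈ U
        · rw [Set.indicator_of_mem hyU, ← hy]
          congr 1
          ext e
          simp [hyU]
        · rw [Set.indicator_of_notMem hyU, ← measure_empty (μ := gaussSeq)]
          congr 1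
          ext e
          simp [hyU]
      rw [lintegral_congr_ae h2, lintegral_indicator hU, lintegral_const,
        Measure.restrict_apply_univ, Measure.smul_apply, smul_eq_mul]
      ring
    have h3 := congrArg (fun m : Measure (ℕ → ℝ) => m D) key
    simp only [Measure.map_apply measurable_snd hD, Measure.smul_apply, smul_eq_mul,
      Measure.restrict_apply (measurable_snd hD)] at h3
    rw [Measure.smul_apply, smul_eq_mul, ← h3]
    congr 1
    ext z
    simp [and_comm]
  have hcμ : IsFiniteMeasure (c • μ) := μ.smul_finite hcfin
  have hprod := Measure.prod_eq hrect
  rw [Measure.prod_smul_left] at hprod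
  have hcompl := congrArg (fun m : Measure ((Fin p → ℝ) × (ℕ → ℝ)) => m Bᶜ) hprod
  have hself := congrArg (fun m : Measure ((Fin p → ℝ) × (ℕ → ℝ)) => m B) hprod
  simp only [Measure.smul_apply, smul_eq_mul, Measure.restrict_apply hB.compl,
    Measure.restrict_apply hB, Set.compl_inter_self, measure_empty, Set.inter_self,
    mul_eq_zero] at hcompl hself
  rw [eventuallyConst_set]
  rcases hcompl with h0 | h0
  · right
    rw [h0, zero_mul] at hself
    exact measure_eq_zero_iff_ae_notMem.1 hself.symm
  · left
    exact mem_ae_iff.2 h0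

lemma IsInvariantLaw.ergodic_arSkew (hμ : IsInvariantLaw A s μ)
    (hA : spectralRadius ℂ (A.map Complex.ofReal) < 1) :
    Ergodic (arSkew A s) (μ.prod gaussSeq) :=
  ⟨hμ.measurePreserving_arSkew, hμ.preErgodic_arSkew hA⟩

/-- The path of a stationary autoregression is ergodic. -/
lemma IsInvariantLaw.ergodic_shift (hμ : IsInvariantLaw A s μ)
    (hA : spectralRadius ℂ (A.map Complex.ofReal) < 1) :
    Ergodic shift ((μ.prod gaussSeq).map
      fun z : (Fin p → ℝ) × (ℕ → ℝ) => arPath A s z.1 z.2) := by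
  have hm : Measurable fun z : (Fin p → ℝ) × (ℕ → ℝ) => arPath A s z.1 z.2 :=
    measurable_pi_lambda _ fun n => measurable_arPath A s n
  refine hm.measurePreserving _ |>.ergodic_of_ergodic_semiconj (hμ.ergodic_arSkew hA)
    measurable_shift fun z => ?_
  ext1 n
  exact (arPath_succ A s z.1 z.2 n).symm

end Ergodic

/-! ### Path law of the limiting process. -/

section Limit

variable {Ω : Type*} [MeasurableSpace Ω] {P : Measure Ω} {ξ : ℕ → Ω → ℝ}
  {p : ℕ}

lemma limitAR_eq_arPath (θ : Fin p → ℝ) (γ₀ : Ω → Fin p → ℝ) (n : ℕ) (ω : Ω) :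
    limitAR θ ξ P γ₀ n ω
      = arPath (companion θ) (sigmaInf ξ P) (γ₀ ω) (fun n => eps ξ P (n + 1) ω) n := by
  induction n with
  | zero => rfl
  | succ n ih => rw [arPath, ← ih]; rfl

lemma shift_iterate_apply {E : Type*} (h : ℕ) (x : ℕ → E) (n : ℕ) :
    (shift^[h] x) n = x (n + h) := by
  induction h generalizing x with
  | zero => rfl
  | succ h ih =>
    rw [Function.iterate_succ_apply, ih, shift]
    congr 1

/-- A process whose path law is invariant under the shift is strictly stationary. -/
lemma isStrictlyStationary_of_measurePreserving {E : Type*} [MeasurableSpace E] {Y : ℕ → Ω → E}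
    (hY : ∀ n, Measurable (Y n))
    (h : MeasurePreserving shift (P.map fun ω n => Y n ω) (P.map fun ω n => Y n ω)) :
    IsStrictlyStationary Y P := by
  intro k
  have h1 := (h.iterate k).map_eq
  rw [Measure.map_map (h.iterate k).measurable (measurable_pi_lambda _ hY)] at h1
  rw [← h1]
  congr 1
  ext ω n
  exact (shift_iterate_apply k (fun n => Y n ω) n).symm

lemma measurable_limitAR (hξ : IsStationaryGaussianNoise ξ P) (θ : Fin p → ℝ)
    {γ₀ : Ω → Fin p → ℝ} (hγ : Measurable γ₀) (n : ℕ) : Measurable (limitAR θ ξ P γ₀ n) := by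
  have he : Measurable fun ω (n : ℕ) => eps ξ P (n + 1) ω :=
    measurable_pi_lambda _ fun n => hξ.measurable_eps (by lia)
  have h := (measurable_arPath (companion θ) (sigmaInf ξ P) n).comp (hγ.prodMk he)
  convert h using 1
  ext1 ω
  exact limitAR_eq_arPath θ γ₀ n ω

variable [IsProbabilityMeasure P]

/-- Independence of `γ₀` from the noise makes their joint law a product, which transfers ergodicity
from the skew product to `γ`. -/
lemma IsStationaryGaussianNoise.map_limitAR (hξ : IsStationaryGaussianNoise ξ P)
    (hr : IsNondegenerate (autocov ξ P)) (θ : Fin p → ℝ) {γ₀ : Ω → Fin p → ℝ}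
    (hγ : Measurable γ₀) (hind : IndepFun γ₀ (fun ω (n : ℕ) => eps ξ P (n + 1) ω) P) :
    P.map (fun ω n => limitAR θ ξ P γ₀ n ω)
      = ((P.map γ₀).prod gaussSeq).map fun z : (Fin p → ℝ) × (ℕ → ℝ) =>
          arPath (companion θ) (sigmaInf ξ P) z.1 z.2 := by
  have hlaw := hξ.hasLaw_eps_seq hr
  have hm : Measurable fun z : (Fin p → ℝ) × (ℕ → ℝ) =>
      arPath (companion θ) (sigmaInf ξ P) z.1 z.2 :=
    measurable_pi_lambda _ fun n => measurable_arPath _ _ n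
  have h1 := (indepFun_iff_map_prod_eq_prod_map_map hγ.aemeasurable hlaw.aemeasurable).1 hind
  rw [hlaw.map_eq] at h1
  have he : Measurable fun ω (n : ℕ) => eps ξ P (n + 1) ω :=
    measurable_pi_lambda _ fun n => hξ.measurable_eps (by lia)
  rw [← h1, Measure.map_map hm (hγ.prodMk he)]
  congr 1
  ext ω n : 2
  exact limitAR_eq_arPath θ γ₀ n ω

end Limit

end ARNoise

theorem proposition5p1 {Ω : Type*} [MeasurableSpace Ω] (P : Measure Ω) [IsProbabilityMeasure P]
    (p : ℕ) (hp : 1 ≤ p) (θ : Fin p → ℝ) (ξ : ℕ → Ω → ℝ)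
    (hξ : ARNoise.IsStationaryGaussianNoise ξ P)
    (hvar : 0 < ARNoise.autocov ξ P 0)
    -- spectral radius of the companion matrix less than one
    (H₁ : spectralRadius ℂ ((ARNoise.companion θ).map Complex.ofReal) < 1)
    -- decay of the covariance function
    (H₂ : ∃ α : ℝ, 0 < α ∧ ARNoise.autocov ξ P =O[atTop] fun n : ℕ => (n : ℝ) ^ (-α))
    -- decay of the partial autocorrelation function
    (H₃ : ∃ α : ℝ, 1 < α ∧
      (fun n : ℕ => ARNoise.pacf ξ P n ^ 2) =O[atTop] fun n : ℕ => (n : ℝ) ^ (-α)) :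
    -- the filtered process is the Markov process `ζ`
    (∀ n, ∀ᵐ ω ∂P, ARNoise.filteredProcess θ ξ P n ω = ARNoise.zeta θ ξ P n ω) ∧
    -- `σ_∞` is a genuine positive limit
    (0 < ARNoise.sigmaInf ξ P ∧
      Tendsto (ARNoise.sigma ξ P) atTop (𝓝 (ARNoise.sigmaInf ξ P))) ∧
    -- the autoregression has exactly one stationary distribution
    (∃! μ : Measure (Fin p → ℝ),
      ARNoise.IsInvariantLaw (ARNoise.companion θ) (ARNoise.sigmaInf ξ P) μ) ∧
    ∀ γ₀ : Ω → Fin p → ℝ, Measurable γ₀ →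
      ARNoise.IsInvariantLaw (ARNoise.companion θ) (ARNoise.sigmaInf ξ P) (P.map γ₀) →
      -- if `γ₀` is independent of the noise, `γ` is strictly stationary and ergodic
      (IndepFun γ₀ (fun ω (n : ℕ) => ARNoise.eps ξ P (n + 1) ω) P →
        ARNoise.IsStrictlyStationary (ARNoise.limitAR θ ξ P γ₀) P ∧
        ARNoise.IsErgodicProcess (ARNoise.limitAR θ ξ P γ₀) P) ∧
      -- the Euclidean distance between `ζ_n^{(1)}` and `γ_n` tends to zero almost surely
      ∀ᵐ ω ∂P, Tendsto
        (fun n => ‖WithLp.toLp 2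
          (ARNoise.zetaFirst θ ξ P n ω - ARNoise.limitAR θ ξ P γ₀ n ω)‖) atTop (𝓝 0) := by
  obtain ⟨α, hα, hr⟩ := H₂
  obtain ⟨α', hα', hβ⟩ := H₃
  have hr0 : Tendsto (ARNoise.autocov ξ P) atTop (𝓝 0) :=
    hr.trans_tendsto ((tendsto_rpow_neg_atTop hα).comp tendsto_natCast_atTop_atTop)
  have hnd := hξ.nondegenerate hvar hr0
  have hsum : Summable fun n => ARNoise.pacf ξ P n ^ 2 :=
    summable_of_isBigO_nat (Real.summable_nat_rpow.2 (by linarith)) hβ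
  obtain ⟨hpos, hlim, -⟩ := hξ.tendsto_sigma hnd hsum
  refine ⟨hξ.filteredProcess_eq_zeta hnd θ, ⟨hpos, hlim⟩, ?_,
    fun γ₀ hγ hinv => ⟨fun hind => ?_, ?_⟩⟩
  · obtain ⟨μ, hμ⟩ := ARNoise.exists_isInvariantLaw (s := ARNoise.sigmaInf ξ P) H₁
    exact ⟨μ, hμ, fun μ' hμ' => hμ'.eq H₁ hμ⟩
  · have herg := hinv.ergodic_shift H₁
    rw [← hξ.map_limitAR hnd θ hγ hind] at herg
    exact ⟨ARNoise.isStrictlyStationary_of_measurePreserving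
      (ARNoise.measurable_limitAR hξ θ hγ) herg.toMeasurePreserving, herg⟩
  · filter_upwards [hξ.tendsto_zetaFirst_sub_limitAR hnd θ H₁ hα' hβ γ₀] with ω hω
    -- The convergence was obtained in the sup norm; continuity of `toLp` carries it to the
    -- Euclidean norm.
    have h := (((PiLp.continuous_toLp 2 fun _ : Fin p => ℝ).tendsto 0).comp hω).norm
    simpa using h
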